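/- **Setting.** Let $q\ge 2$, $r\ge 2$ be integers, let $\pi$ be a distribution of full support on $[q]$, and let $B:[q]\to[q]^{r-1}$ be a channel (probability kernel) with $\sum_{k}\pi_k\sum_{x:\,x_i=j}B(x\mid k)=\pi_j$ for all $i\in[r-1]$, $j\in[q]$. Let $T$ be a fixed, locally finite, $r$-uniform linear hypertree with root $\rho$ (finite or infinite). In the model $\mathrm{BOHT}(T,q,r,\pi,B)$ the root label is $\sigma_\rho\sim\pi$ and, given $\sigma_u$, for every downward hyperedge $\{u,v_1,\dots,v_{r-1}\}$ the labels $(\sigma_{v_1},\dots,\sigma_{v_{r-1}})$ are drawn from $B(\cdot\mid\sigma_u)$, independently over hyperedges. Let $L_k$ be the set of vertices at distance $k$ from $\rho$. *Reconstruction is impossible* if $\lim_{k\to\infty}I(\sigma_\rho;\sigma_{L_k})=0$, where $I$ is mutual information. **Branching number.** Write $c(u)$ for the children of $u$ (the other vertices of the downward hyperedges of $u$) and $d(u)$ for the depth of $u$. A flow is a function $f:V(T)\to\mathbb R_{\ge0}$ with $f_u=\sum_{v\in c(u)}f_v$ for every $u$. Then $\mathrm{br}(T)\in[0,\infty]$ is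 the supremum of all $\lambda>0$ for which there is a flow $f$ with $f_\rho>0$ and $f_u\le\lambda^{-d(u)}$ for all $u$ (and $\mathrm{br}(T)=0$ if there is none); we use $\infty\cdot 0=0$. **Contraction coefficients.** For $f\in\{\mathrm{KL},\chi^2,\mathrm{SKL}\}$ (the $f$-divergences of $x\log x$, $(x-1)^2$, $(x-1)\log x$) let $I_f(\pi,P)=D_f(P_{XY}\,\|\,P_X\otimes P_Y)$, where $X\sim\pi$ and $Y$ is the output of the channel $P$ at $X$. Define $$\eta^{(m,ht)}_f(\pi,B)=\sup_{P_1,\dots,P_{r-1}}\frac{I_f(\pi,(P_1\times\cdots\times P_{r-1})\circ B)}{\sum_{i}I_f(\pi,P_i)}$$ over all channels $P_1,\dots,P_{r-1}$ with input alphabet $[q]$ and $0<\sum_i I_f(\pi,P_i)<\infty$. A channel $P:\{\pm\}\to\mathcal Y$ is BMS if there is a measurable involution $s$ of $\mathcal Y$ with $P(E\mid+)=P(s(E)\mid-)$ for all measurable $E$; then $C_f(P)=I_f(\mathrm{Unif}\{\pm\},P)$. The model is *binary symmetric* if $q=2$, $\pi=\mathrm{Unif}\{\pm\}$ and $B$ is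 BMS with respect to the coordinatewise sign flip of $\{\pm\}^{r-1}$; in that case $\eta^{(m,ht,s)}_f(B)$ is the supremum of $C_f((P_1\times\cdots\times P_{r-1})\circ B)/\sum_iC_f(P_i)$ over BMS channels $P_1,\dots,P_{r-1}$ with $0<\sum_iC_f(P_i)<\infty$. **Theorem.** Consider the model $\mathrm{BOHT}(T,q,r,\pi,B)$. (i) Reconstruction is impossible if - $\mathrm{br}(T)\,\eta^{(m,ht)}_{\mathrm{KL}}(\pi,B)<1$, or - $\mathrm{br}(T)\,\eta^{(m,ht)}_{\mathrm{SKL}}(\pi,B)<1$, $I_{\mathrm{SKL}}(\pi,B)<\infty$, and $T$ has bounded maximum degree. (ii) If the model is binary symmetric, reconstruction is impossible if - $\mathrm{br}(T)\,\eta^{(m,ht,s)}_{\mathrm{KL}}(B)<1$, or - $\mathrm{br}(T)\,\eta^{(m,ht,s)}_{\chi^2}(B)<1$, or - $\mathrm{br}(T)\,\eta^{(m,ht,s)}_{\mathrm{SKL}}(B)<1$, $C_{\mathrm{SKL}}(B)<\infty$, and $T$ has bounded maximum degree. -/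

import Mathlib

open MeasureTheory ProbabilityTheory InformationTheory Filter
open scoped ENNReal NNReal Topology

noncomputable section

namespace BOHT

universe u v w

/-! ### Divergences, mutual information and channels -/

/-- The `χ²`-divergence `∫ (dμ/dν - 1)² dν`, equal to `∞` when `μ` is not absolutely continuous
with respect to `ν`. -/
def chiSqDiv {Ω : Type u} [MeasurableSpace Ω] (μ ν : Measure Ω) : ℝ≥0∞ :=
  open Classical in
  if μ ≪ ν then ∫⁻ x, ENNReal.ofReal (((μ.rnDeriv ν x).toReal - 1) ^ 2) ∂ν else ∞

/-- The symmetric Kullback-Leibler divergence `D(μ‖ν) + D(ν‖μ)`, that is, the `f`-divergence of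
`f(x) = (x - 1) log x` (with `f(0) = ∞`). -/
def sklDiv {Ω : Type u} [MeasurableSpace Ω] (μ ν : Measure Ω) : ℝ≥0∞ :=
  klDiv μ ν + klDiv ν μ

/-- The three divergences under consideration. -/
inductive Divergence
  | kl
  | chiSq
  | skl

/-- The value `D_f(μ‖ν)` of each of the three divergences. -/
def Divergence.div {Ω : Type u} [MeasurableSpace Ω] (f : Divergence) (μ ν : Measure Ω) : ℝ≥0∞ :=
  match f with
  | .kl => klDiv μ ν
  | .chiSq => chiSqDiv μ ν
  | .skl => sklDiv μ ν

/-- The `f`-information `I_f(X; Y) = D_f(P_{XY} ‖ P_X ⊗ P_Y)` of a pair with joint law `J`. -/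
def jointInfo {α : Type u} {β : Type v} [MeasurableSpace α] [MeasurableSpace β]
    (f : Divergence) (J : Measure (α × β)) : ℝ≥0∞ :=
  f.div J (J.fst.prod J.snd)

/-- The `f`-information `I_f(π, P)` of the pair `(X, Y)` where `X` has law `π` and `Y` is the
output of the channel `P` at the input `X`. -/
def channelInfo {α : Type u} {β : Type v} [MeasurableSpace α] [MeasurableSpace β]
    (f : Divergence) (π : Measure α) (P : Kernel α β) : ℝ≥0∞ :=
  jointInfo f (π ⊗ₘ P)

/-- The tensor product `P₁ × ⋯ × Pₙ` of channels with input alphabet `[q]`: the channels act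
independently on the coordinates of the input. -/
def tensorChannel {q n : ℕ} {Y : Fin n → Type u} [∀ i, MeasurableSpace (Y i)]
    (P : ∀ i, Kernel (Fin q) (Y i)) : Kernel (Fin n → Fin q) (∀ i, Y i) :=
  Kernel.ofFunOfCountable fun x => Measure.pi fun i => P i (x i)

/-- A channel `P` with binary input alphabet (`0` stands for `+` and `1` for `-`) is symmetric
with respect to the involution `s` of its output alphabet. -/
def IsBMSWith {Y : Type u} [MeasurableSpace Y] (P : Kernel (Fin 2) Y) (s : Y → Y) : Prop :=
  Measurable s ∧ Function.Involutive s ∧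
    ∀ E : Set Y, MeasurableSet E → P 0 E = P 1 (s '' E)

/-- Binary memoryless symmetric (BMS) channels. -/
def IsBMS {Y : Type u} [MeasurableSpace Y] (P : Kernel (Fin 2) Y) : Prop :=
  ∃ s : Y → Y, IsBMSWith P s

/-- The coordinatewise sign flip of `{+, -}ⁿ`. -/
def signFlip {n : ℕ} (x : Fin n → Fin 2) : Fin n → Fin 2 :=
  fun i => Equiv.swap 0 1 (x i)

/-- The uniform distribution on the binary alphabet. -/
def unifBinary : Measure (Fin 2) := uniformOn Set.univ

/-! ### Broadcasting channels and multi-terminal contraction coefficients -/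

/-- The parameters `(π, B)` of a broadcasting model with alphabet `[q]` on `r`-uniform hypertrees:
a fully supported distribution `π` and a channel `B : [q] → [q]^{r-1}` each of whose
one-coordinate marginals preserves `π`. -/
structure Params (q r : ℕ) where
  π : Measure (Fin q)
  isProbabilityMeasure : IsProbabilityMeasure π
  full_support : ∀ j, π {j} ≠ 0
  B : Kernel (Fin q) (Fin (r - 1) → Fin q)
  isMarkovKernel : IsMarkovKernel B
  stationary : ∀ (i : Fin (r - 1)) (j : Fin q), ∑ k, π {k} * B k {x | x i = j} = π {j}

/-- The heterogeneous multi-terminal contraction coefficient `η_f^{(m,ht)}(π, B)`. -/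
def etaHet {q r : ℕ} (f : Divergence) (M : Params q r) : ℝ≥0∞ :=
  ⨆ (Y : Fin (r - 1) → Type) (_ : ∀ i, MeasurableSpace (Y i))
    (P : ∀ i, Kernel (Fin q) (Y i)) (_ : ∀ i, IsMarkovKernel (P i))
    (_ : 0 < ∑ i, channelInfo f M.π (P i)) (_ : ∑ i, channelInfo f M.π (P i) < ∞),
    channelInfo f M.π (tensorChannel P ∘ₖ M.B) / ∑ i, channelInfo f M.π (P i)

/-- The model is binary symmetric: `π` is uniform on the binary alphabet and `B` together with the
coordinatewise sign flip is a BMS channel. -/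
def Params.IsBinarySymmetric {r : ℕ} (M : Params 2 r) : Prop :=
  M.π = unifBinary ∧ IsBMSWith M.B signFlip

/-- The `f`-capacity `C_f(P)` of a BMS channel: its `f`-information at the uniform input. -/
def capacity {Y : Type u} [MeasurableSpace Y] (f : Divergence) (P : Kernel (Fin 2) Y) : ℝ≥0∞ :=
  channelInfo f unifBinary P

/-- The heterogeneous multi-terminal contraction coefficient `η_f^{(m,ht,s)}(B)` restricted to
BMS channels. -/
def etaHetSymm {r : ℕ} (f : Divergence) (M : Params 2 r) : ℝ≥0∞ :=
  ⨆ (Y : Fin (r - 1) → Type) (_ : ∀ i, MeasurableSpace (Y i))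
    (P : ∀ i, Kernel (Fin 2) (Y i)) (_ : ∀ i, IsMarkovKernel (P i)) (_ : ∀ i, IsBMS (P i))
    (_ : 0 < ∑ i, capacity f (P i)) (_ : ∑ i, capacity f (P i) < ∞),
    capacity f (tensorChannel P ∘ₖ M.B) / ∑ i, capacity f (P i)

/-! ### Rooted hypertrees -/

/-- Rooted `r`-uniform linear hypertrees with vertex set `V` and hyperedge set `E`. The hyperedge
`e` is `{top e, child e 0, …, child e (r - 2)}`, where `top e` is its vertex closest to the root;
the other vertices come in an arbitrary order (the channel `B` need not be exchangeable). Every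
vertex other than the root is a non-top vertex of exactly one hyperedge, and `depth` is the
distance to the root. -/
structure RootedHypertree (r : ℕ) (V : Type u) (E : Type v) where
  root : V
  top : E → V
  child : E → Fin (r - 1) → V
  depth : V → ℕ
  depth_root : depth root = 0
  depth_child : ∀ e i, depth (child e i) = depth (top e) + 1
  exists_child : ∀ w, w ≠ root → ∃ e i, child e i = w
  child_inj : ∀ e i e' i', child e i = child e' i' → e = e' ∧ i = i'

namespace RootedHypertree

variable {r : ℕ} {V : Type u} {E : Type v} (T : RootedHypertree r V E)

/-- The set of vertices of a hyperedge. -/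
def edgeSet (e : E) : Set V := insert (T.top e) (Set.range (T.child e))

/-- Sanity check: each hyperedge has exactly `r` vertices. -/
theorem ncard_edgeSet (hr : 1 ≤ r) (e : E) : (T.edgeSet e).ncard = r := by
  have hinj : Function.Injective (T.child e) := fun i j h => (T.child_inj _ _ _ _ h).2
  have hnot : T.top e ∉ Set.range (T.child e) := by
    rintro ⟨i, hi⟩
    have := T.depth_child e i
    rw [hi] at this
    omega
  rw [edgeSet, Set.ncard_insert_of_notMem hnot (Set.finite_range _), ← Set.image_univ,
    Set.ncard_image_of_injective _ hinj, Set.ncard_univ, Nat.card_eq_fintype_card,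
    Fintype.card_fin]
  omega

/-- Sanity check: two distinct hyperedges share at most one vertex. -/
theorem linear {e e' : E} (h : e ≠ e') : (T.edgeSet e ∩ T.edgeSet e').Subsingleton := by
  rintro a ⟨ha, ha'⟩ b ⟨hb, hb'⟩
  rcases ha with rfl | ⟨i, rfl⟩ <;> rcases hb with rfl | ⟨j, rfl⟩
  · rfl
  · rcases ha' with ha' | ⟨i', hi'⟩ <;> rcases hb' with hb' | ⟨j', hj'⟩
    · have := T.depth_child e j
      rw [hb', ha'] at this
      omega
    · exact absurd (T.child_inj _ _ _ _ hj').1.symm h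
    · have h1 := T.depth_child e j
      have h2 := T.depth_child e' i'
      rw [hb'] at h1
      rw [hi'] at h2
      omega
    · exact absurd (T.child_inj _ _ _ _ hj').1.symm h
  · rcases ha' with ha' | ⟨i', hi'⟩ <;> rcases hb' with hb' | ⟨j', hj'⟩
    · have := T.depth_child e i
      rw [ha', hb'] at this
      omega
    · have h1 := T.depth_child e i
      have h2 := T.depth_child e' j'
      rw [ha'] at h1
      rw [hj'] at h2
      omega
    · exact absurd (T.child_inj _ _ _ _ hi').1.symm h
    · exact absurd (T.child_inj _ _ _ _ hi').1.symm h
  · rcases ha' with ha' | ⟨i', hi'⟩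
    · rcases hb' with hb' | ⟨j', hj'⟩
      · rw [ha', hb']
      · exact absurd (T.child_inj _ _ _ _ hj').1.symm h
    · exact absurd (T.child_inj _ _ _ _ hi').1.symm h

/-- Every vertex belongs to finitely many hyperedges. -/
def LocallyFinite : Prop := ∀ w, {e | w ∈ T.edgeSet e}.Finite

/-- The degrees (numbers of hyperedges containing a vertex) are bounded. -/
def BoundedDegree : Prop := ∃ N : ℕ, ∀ w, {e | w ∈ T.edgeSet e}.encard ≤ N

/-- `c` is a child of `w`. -/
def IsChild (w c : V) : Prop := ∃ e i, T.top e = w ∧ T.child e i = c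

/-- `f` is a flow: the value at each vertex is the sum of the values at its children. -/
def IsFlow (f : V → ℝ≥0) : Prop :=
  ∀ w, HasSum (fun c : {c // T.IsChild w c} => f c) (f w)

/-- The branching number, in `[0, ∞]`: the supremum of all `l > 0` for which there is a flow `f`
with `f(root) > 0` and `f(w) ≤ l ^ (-depth w)` for all vertices `w`. -/
def branchingNumber : ℝ≥0∞ :=
  ⨆ (l : ℝ≥0) (_ : 0 < l ∧ ∃ f : V → ℝ≥0, T.IsFlow f ∧ 0 < f T.root ∧
    ∀ w, f w ≤ (l ^ T.depth w)⁻¹), (l : ℝ≥0∞)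

/-- The vertices at distance at most `k` from the root. -/
abbrev Ball (k : ℕ) : Type u := {w : V // T.depth w ≤ k}

/-- The vertices at distance exactly `k` from the root. -/
abbrev Level (k : ℕ) : Type u := {w : V // T.depth w = k}

/-- The hyperedges all of whose vertices are at distance at most `k` from the root. -/
abbrev BallEdge (k : ℕ) : Type v := {e : E // T.depth (T.top e) + 1 ≤ k}

/-- The root, as a vertex of a ball. -/
def ballRoot (k : ℕ) : T.Ball k := ⟨T.root, by simp [T.depth_root]⟩

/-- The top vertex of a hyperedge of a ball. -/
def ballTop {k : ℕ} (e : T.BallEdge k) : T.Ball k := ⟨T.top e, by have := e.2; omega⟩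

/-- The other vertices of a hyperedge of a ball. -/
def ballChild {k : ℕ} (e : T.BallEdge k) (i : Fin (r - 1)) : T.Ball k :=
  ⟨T.child e i, by rw [T.depth_child]; exact e.2⟩

/-- The vertices at distance `k` from the root, as vertices of the ball of radius `k`. -/
def ballOfLevel {k : ℕ} (w : T.Level k) : T.Ball k := ⟨w.1, w.2.le⟩

/-! ### Broadcasting on a fixed hypertree -/

variable {q : ℕ}

/-- The probability that the downward process labels the ball of radius `k` by `x`: the root has
law `π` and, given the label of its top vertex, the other labels of each hyperedge are drawn
according to `B`, independently over hyperedges. -/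
def labelProb (M : Params q r) (k : ℕ) (x : T.Ball k → Fin q) : ℝ≥0∞ :=
  M.π {x (T.ballRoot k)} *
    ∏ᶠ e : T.BallEdge k, M.B (x (T.ballTop e)) {fun i => x (T.ballChild e i)}

/-- The joint law of the labels `(σ_w)` of the vertices `w` at distance at most `k` from the root
in the broadcasting model (for a locally finite hypertree, where this ball is finite). -/
def ballLaw (M : Params q r) (k : ℕ) : Measure (T.Ball k → Fin q) :=
  Measure.sum fun x => T.labelProb M k x • Measure.dirac x

/-- The joint law of the label `σ_ρ` of the root and of the labels `σ_{L_k}` of the vertices at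
distance `k` from the root. -/
def rootLevelLaw (M : Params q r) (k : ℕ) : Measure (Fin q × (T.Level k → Fin q)) :=
  (T.ballLaw M k).map fun x => (x (T.ballRoot k), fun w => x (T.ballOfLevel w))

/-- Reconstruction is impossible: the mutual information `I(σ_ρ; σ_{L_k})` tends to `0`. -/
def ReconstructionImpossible (M : Params q r) : Prop :=
  Tendsto (fun k => jointInfo .kl (T.rootLevelLaw M k)) atTop (𝓝 0)

end RootedHypertree

end BOHT

end

/-! Let `a n v` be the `f`-information between the label of `v` and the labels `n` levels below it.
Given the label of `v`, what is seen through different downward hyperedges is independent,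
`f`-information is subadditive over such observations, and a single hyperedge contracts it by the
coefficient `η`. Hence `a (n + 1) v ≤ η * ∑ a n c` over the children `c` of `v`
(`info_chan_succ_le`).

Consequently `η ^ depth v * a (K - depth v) v` is, on the ball of radius `K`, a subflow bounded by
`C * η ^ depth v`, where `C` bounds the information uniformly. If `a K root` did not tend to `0`,
trimming these subflows to flows and passing to a limit by compactness would give a nonzero flow
with that bound, so that `br(T) ≥ 1 / η`, against `br(T) η < 1` (`LocallyFinite.exists_flow_le`,
`LocallyFinite.le_branchingNumber`, `LocallyFinite.tendsto_zero_of_contraction`). Each of the three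
informations dominates the KL one, so mutual information tends to `0` as well.

Two inputs depend on `f`. Subadditivity: for KL the defect is the mutual information of the two
observations; SKL is exactly additive when finite; for `χ²` it is proved for symmetric channels by
averaging over the symmetry. Uniform bound: KL and `χ²` informations are at most `q`; for SKL one
starts one level down and uses bounded degree and finiteness of the information of `B`.

The process itself enters through `tsum_labelProb_mul`, which integrates out the labels of a ball
and identifies the law of root and level with an iterated channel (`jointInfo_rootLevelLaw_le`). -/

set_option linter.unusedSectionVars false

namespace BOHT

/-! ### Divergences on finite spaces -/

section FiniteSpace

variable {Ω : Type*} [Fintype Ω] [MeasurableSpace Ω] [MeasurableSingletonClass Ω]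

theorem absolutelyContinuous_of_singleton {μ ν : Measure Ω}
    (h : ∀ x, ν {x} = 0 → μ {x} = 0) : μ ≪ ν := by
  refine Measure.AbsolutelyContinuous.mk fun s _ hs => ?_
  rw [← Set.biUnion_of_singleton s]
  refine (measure_biUnion_null_iff (Set.to_countable s)).2 fun x hx => h x ?_
  exact measure_mono_null (Set.singleton_subset_iff.2 hx) hs

theorem measure_le_of_singleton {μ ν : Measure Ω} (h : ∀ x, μ {x} ≤ ν {x}) : μ ≤ ν := by
  refine Measure.le_iff.2 fun s _ => ?_
  rw [← Set.biUnion_of_singleton s, measure_biUnion (Set.to_countable s)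
      (fun x _ y _ hxy => by simpa using hxy) (fun _ _ => measurableSet_singleton _),
    measure_biUnion (Set.to_countable s)
      (fun x _ y _ hxy => by simpa using hxy) (fun _ _ => measurableSet_singleton _)]
  exact ENNReal.tsum_le_tsum fun x => h x

theorem toReal_rnDeriv_of_ne_zero {μ ν : Measure Ω} [IsFiniteMeasure μ] [IsFiniteMeasure ν]
    (h : μ ≪ ν) {x : Ω} (hx : ν {x} ≠ 0) :
    (μ.rnDeriv ν x).toReal = μ.real {x} / ν.real {x} := by
  have h1 : μ.rnDeriv ν x * ν {x} = μ {x} := by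
    rw [← lintegral_singleton, ← withDensity_apply _ (measurableSet_singleton x),
      Measure.withDensity_rnDeriv_eq _ _ h]
  have h2 : ν.real {x} ≠ 0 := by
    rw [Measure.real, ENNReal.toReal_ne_zero]
    exact ⟨hx, measure_ne_top _ _⟩
  rw [eq_div_iff h2, Measure.real, Measure.real, ← ENNReal.toReal_mul, h1]

theorem integral_llr_eq_sum {μ ν : Measure Ω} [IsFiniteMeasure μ] [IsFiniteMeasure ν]
    (h : μ ≪ ν) :
    ∫ x, llr μ ν x ∂μ = ∑ x, μ.real {x} * Real.log (μ.real {x} / ν.real {x}) := by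
  rw [integral_fintype Integrable.of_finite]
  refine Finset.sum_congr rfl fun x _ => ?_
  by_cases hx : ν {x} = 0
  · simp [Measure.real, h hx]
  · rw [llr, toReal_rnDeriv_of_ne_zero h hx, smul_eq_mul]

theorem klDiv_eq_sum {μ ν : Measure Ω} [IsProbabilityMeasure μ] [IsProbabilityMeasure ν]
    (h : μ ≪ ν) :
    klDiv μ ν = ENNReal.ofReal (∑ x, μ.real {x} * Real.log (μ.real {x} / ν.real {x})) := by
  rw [klDiv_of_ac_of_integrable h Integrable.of_finite, integral_llr_eq_sum h]
  simp

theorem sum_mul_log_div_nonneg {μ ν : Measure Ω} [IsProbabilityMeasure μ]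
    [IsProbabilityMeasure ν] (h : μ ≪ ν) :
    0 ≤ ∑ x, μ.real {x} * Real.log (μ.real {x} / ν.real {x}) := by
  have := integral_llr_add_sub_measure_univ_nonneg h Integrable.of_finite
  rw [integral_llr_eq_sum h] at this
  simpa using this

theorem chiSqDiv_eq_sum {μ ν : Measure Ω} [IsFiniteMeasure μ] [IsFiniteMeasure ν]
    (h : μ ≪ ν) :
    chiSqDiv μ ν = ENNReal.ofReal (∑ x, ν.real {x} * (μ.real {x} / ν.real {x} - 1) ^ 2) := by
  rw [chiSqDiv, if_pos h, lintegral_fintype, ENNReal.ofReal_sum_of_nonneg fun x _ => by positivity]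
  refine Finset.sum_congr rfl fun x _ => ?_
  by_cases hx : ν {x} = 0
  · simp [Measure.real, hx]
  · rw [toReal_rnDeriv_of_ne_zero h hx, mul_comm, ENNReal.ofReal_mul measureReal_nonneg,
      ofReal_measureReal]

end FiniteSpace

theorem Divergence.div_self {Ω : Type*} [MeasurableSpace Ω] (f : Divergence) (μ : Measure Ω)
    [IsFiniteMeasure μ] : f.div μ μ = 0 := by
  cases f with
  | kl => exact klDiv_self μ
  | skl => simp [Divergence.div, sklDiv, klDiv_self]
  | chiSq =>
    simp only [Divergence.div, chiSqDiv, Measure.AbsolutelyContinuous.rfl, if_true]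
    rw [lintegral_congr_ae (g := fun _ => 0)]
    · simp
    · filter_upwards [Measure.rnDeriv_self μ] with x hx
      simp [hx]

/-! ### The information of a channel between finite alphabets -/

section FiniteChannel

variable {α β : Type*} [Fintype α] [MeasurableSpace α] [MeasurableSingletonClass α]
  [Fintype β] [MeasurableSpace β] [MeasurableSingletonClass β]

/-- The probability that the channel `P` outputs `y` when the input has law `π`. -/
noncomputable def outProb (π : Measure α) (P : Kernel α β) (y : β) : ℝ :=
  ∑ a, π.real {a} * (P a).real {y}

/-- All output laws of `P` have the same support. -/
def EqualSupport (P : Kernel α β) : Prop :=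
  ∀ a b y, (P a).real {y} = 0 → (P b).real {y} = 0

variable (π : Measure α) [IsProbabilityMeasure π] (P : Kernel α β) [IsMarkovKernel P]

theorem compProd_singleton (a : α) (y : β) : (π ⊗ₘ P) {(a, y)} = π {a} * P a {y} := by
  rw [← Set.singleton_prod_singleton, Measure.compProd_apply_prod (measurableSet_singleton _)
    (measurableSet_singleton _), lintegral_singleton, mul_comm]

theorem compProd_real_singleton (x : α × β) :
    (π ⊗ₘ P).real {x} = π.real {x.1} * (P x.1).real {x.2} := by
  obtain ⟨a, y⟩ := x
  simp only [Measure.real, compProd_singleton, ENNReal.toReal_mul]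

theorem comp_real_singleton (y : β) : (P ∘ₘ π).real {y} = outProb π P y := by
  rw [Measure.real, Measure.bind_apply (measurableSet_singleton _) P.measurable.aemeasurable,
    lintegral_fintype, ENNReal.toReal_sum fun a _ =>
      ENNReal.mul_ne_top (measure_ne_top _ _) (measure_ne_top _ _), outProb]
  exact Finset.sum_congr rfl fun a _ => by rw [ENNReal.toReal_mul, mul_comm]; rfl

theorem prod_real_singleton (x : α × β) :
    (π.prod (P ∘ₘ π)).real {x} = π.real {x.1} * outProb π P x.2 := by
  obtain ⟨a, y⟩ := x
  rw [← Set.singleton_prod_singleton, measureReal_prod_prod, comp_real_singleton]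

theorem channelInfo_eq_div (f : Divergence) :
    channelInfo f π P = f.div (π ⊗ₘ P) (π.prod (P ∘ₘ π)) := by
  rw [channelInfo, jointInfo, Measure.fst_compProd, Measure.snd_compProd]

theorem outProb_nonneg (y : β) : 0 ≤ outProb π P y :=
  Finset.sum_nonneg fun _ _ => by positivity

theorem mul_le_outProb (a : α) (y : β) : π.real {a} * (P a).real {y} ≤ outProb π P y :=
  Finset.single_le_sum (f := fun a => π.real {a} * (P a).real {y})
    (fun _ _ => by positivity) (Finset.mem_univ a)

theorem sum_real_singleton_eq_one (μ : Measure β) [IsProbabilityMeasure μ] :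
    ∑ y, μ.real {y} = 1 := by
  rw [sum_measureReal_singleton]; simp

theorem sum_outProb : ∑ y, outProb π P y = 1 := by
  simp_rw [← comp_real_singleton]
  exact sum_real_singleton_eq_one _

theorem compProd_absolutelyContinuous : π ⊗ₘ P ≪ π.prod (P ∘ₘ π) := by
  refine absolutelyContinuous_of_singleton fun x hx => ?_
  rw [← measureReal_eq_zero_iff] at hx ⊢
  rw [prod_real_singleton, mul_eq_zero] at hx
  rw [compProd_real_singleton]
  rcases hx with hx | hx
  · simp [hx]
  · exact le_antisymm ((mul_le_outProb π P _ _).trans hx.le) (by positivity)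

theorem channelInfo_kl_eq : channelInfo .kl π P = ENNReal.ofReal
    (∑ a, ∑ y, π.real {a} * (P a).real {y} * Real.log ((P a).real {y} / outProb π P y)) := by
  rw [channelInfo_eq_div]
  simp only [Divergence.div]
  rw [klDiv_eq_sum (compProd_absolutelyContinuous π P), Fintype.sum_prod_type]
  congr 1
  refine Finset.sum_congr rfl fun a _ => Finset.sum_congr rfl fun y _ => ?_
  rw [compProd_real_singleton, prod_real_singleton]
  by_cases ha : π.real {a} = 0
  · simp [ha]
  · rw [mul_div_mul_left _ _ ha]

theorem channelInfo_chiSq_eq : channelInfo .chiSq π P = ENNReal.ofReal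
    (∑ a, ∑ y, π.real {a} * outProb π P y * ((P a).real {y} / outProb π P y - 1) ^ 2) := by
  rw [channelInfo_eq_div]
  simp only [Divergence.div]
  rw [chiSqDiv_eq_sum (compProd_absolutelyContinuous π P), Fintype.sum_prod_type]
  congr 1
  refine Finset.sum_congr rfl fun a _ => Finset.sum_congr rfl fun y _ => ?_
  rw [compProd_real_singleton, prod_real_singleton]
  by_cases ha : π.real {a} = 0
  · simp [ha]
  · rw [mul_div_mul_left _ _ ha]

theorem prod_absolutelyContinuous (hπ : ∀ a, π {a} ≠ 0) (h : EqualSupport P) :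
    π.prod (P ∘ₘ π) ≪ π ⊗ₘ P := by
  refine absolutelyContinuous_of_singleton fun x hx => ?_
  rw [← measureReal_eq_zero_iff] at hx ⊢
  rw [compProd_real_singleton, mul_eq_zero, measureReal_eq_zero_iff] at hx
  have hx' := hx.resolve_left (hπ _)
  rw [prod_real_singleton, outProb, Finset.sum_eq_zero fun b _ => by rw [h _ b _ hx', mul_zero],
    mul_zero]

/-- Finiteness makes the product law absolutely continuous with respect to the joint law. If input
`a` never produces `y`, then the joint law misses `(a, y)`, so `y` has output probability `0`, and
full support of `π` excludes it for every input. -/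
theorem equalSupport_of_channelInfo_skl (hπ : ∀ a, π {a} ≠ 0)
    (h : channelInfo .skl π P ≠ ∞) : EqualSupport P := by
  rw [channelInfo_eq_div] at h
  simp only [Divergence.div, sklDiv, ne_eq, ENNReal.add_eq_top, not_or] at h
  have hac := (klDiv_ne_top_iff.1 h.2).1
  have hπ' : ∀ a, π.real {a} ≠ 0 := fun a => by
    rw [ne_eq, measureReal_eq_zero_iff]; exact hπ a
  intro a b y hy
  have h1 : (π ⊗ₘ P).real {(a, y)} = 0 := by rw [compProd_real_singleton, hy, mul_zero]
  rw [measureReal_eq_zero_iff] at h1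
  have h2 := hac h1
  rw [← measureReal_eq_zero_iff, prod_real_singleton, mul_eq_zero] at h2
  have h3 := (mul_le_outProb π P b y).trans (h2.resolve_left (hπ' a)).le
  exact (mul_eq_zero.1 (le_antisymm h3 (by positivity))).resolve_left (hπ' b)

theorem sum_sub_outProb (y : β) : ∑ a, π.real {a} * ((P a).real {y} - outProb π P y) = 0 := by
  simp_rw [mul_sub, Finset.sum_sub_distrib, ← Finset.sum_mul]
  rw [sum_real_singleton_eq_one, one_mul, outProb, sub_self]

/-- The two KL terms combine to `(joint - product) * log (P / outProb)`. The part with `log outProb`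
depends on `y` only and vanishes because `P a - outProb` has `π`-mean zero. What remains involves
only `log P`, which splits over product channels. -/
theorem channelInfo_skl_eq (hπ : ∀ a, π {a} ≠ 0) (h : EqualSupport P) :
    channelInfo .skl π P = ENNReal.ofReal
      (∑ a, ∑ y, π.real {a} * ((P a).real {y} - outProb π P y) * Real.log ((P a).real {y})) := by
  have h1 := compProd_absolutelyContinuous π P
  have h2 := prod_absolutelyContinuous π P hπ h
  rw [channelInfo_eq_div]
  simp only [Divergence.div, sklDiv]
  rw [klDiv_eq_sum h1, klDiv_eq_sum h2,
    ← ENNReal.ofReal_add (sum_mul_log_div_nonneg h1) (sum_mul_log_div_nonneg h2),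
    ← Finset.sum_add_distrib, Fintype.sum_prod_type]
  congr 1
  have key : ∀ a y, (π ⊗ₘ P).real {(a, y)} *
        Real.log ((π ⊗ₘ P).real {(a, y)} / (π.prod (P ∘ₘ π)).real {(a, y)}) +
      (π.prod (P ∘ₘ π)).real {(a, y)} *
        Real.log ((π.prod (P ∘ₘ π)).real {(a, y)} / (π ⊗ₘ P).real {(a, y)}) =
      π.real {a} * ((P a).real {y} - outProb π P y) * Real.log ((P a).real {y}) -
        π.real {a} * ((P a).real {y} - outProb π P y) * Real.log (outProb π P y) := by
    intro a y
    have ha : π.real {a} ≠ 0 := by rw [ne_eq, measureReal_eq_zero_iff]; exact hπ a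
    rw [compProd_real_singleton, prod_real_singleton, mul_div_mul_left _ _ ha,
      mul_div_mul_left _ _ ha]
    by_cases hy : (P a).real {y} = 0
    · have h0 : outProb π P y = 0 :=
        Finset.sum_eq_zero fun b _ => by rw [h _ b _ hy, mul_zero]
      simp [hy, h0]
    · have h0 : outProb π P y ≠ 0 := by
        intro h0
        have := (mul_le_outProb π P a y).trans h0.le
        exact hy ((mul_eq_zero.1 (le_antisymm this (by positivity))).resolve_left ha)
      rw [Real.log_div hy h0, Real.log_div h0 hy]
      ring
  simp_rw [key, Finset.sum_sub_distrib]
  rw [sub_eq_self, Finset.sum_comm]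
  refine Finset.sum_eq_zero fun y _ => ?_
  rw [← Finset.sum_mul, sum_sub_outProb, zero_mul]

/-! ### Comparison of the divergences -/

theorem channelInfo_kl_le_skl : channelInfo .kl π P ≤ channelInfo .skl π P := by
  simp only [channelInfo, jointInfo, Divergence.div, sklDiv]
  exact le_self_add

theorem outProb_eq_zero_imp (hπ : ∀ a, π {a} ≠ 0) {y : β} (h : outProb π P y = 0) (a : α) :
    (P a).real {y} = 0 := by
  have ha : π.real {a} ≠ 0 := by rw [ne_eq, measureReal_eq_zero_iff]; exact hπ a
  have := (mul_le_outProb π P a y).trans h.le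
  exact (mul_eq_zero.1 (le_antisymm this (by positivity))).resolve_left ha

/-- Adding the zero sum `h0` turns the `χ²` summand into `π P (P / outProb - 1)`, which dominates
the KL summand because `log x ≤ x - 1`. -/
theorem channelInfo_kl_le_chiSq (hπ : ∀ a, π {a} ≠ 0) :
    channelInfo .kl π P ≤ channelInfo .chiSq π P := by
  rw [channelInfo_kl_eq, channelInfo_chiSq_eq]
  refine ENNReal.ofReal_le_ofReal ?_
  have h0 : ∑ a, ∑ y, π.real {a} * ((P a).real {y} - outProb π P y) = 0 := by
    rw [Finset.sum_comm]
    exact Finset.sum_eq_zero fun y _ => sum_sub_outProb π P y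
  rw [← add_zero (∑ a, ∑ y, _ * (_ - 1) ^ 2), ← h0, ← Finset.sum_add_distrib]
  refine Finset.sum_le_sum fun a _ => ?_
  rw [← Finset.sum_add_distrib]
  refine Finset.sum_le_sum fun y _ => ?_
  by_cases hy : outProb π P y = 0
  · simp [hy, outProb_eq_zero_imp π P hπ hy a]
  · have hw : 0 ≤ (P a).real {y} := measureReal_nonneg
    have hpos : 0 < outProb π P y := lt_of_le_of_ne (outProb_nonneg π P y) (Ne.symm hy)
    have hr : π.real {a} * outProb π P y * ((P a).real {y} / outProb π P y - 1) ^ 2 +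
        π.real {a} * ((P a).real {y} - outProb π P y) =
        π.real {a} * (P a).real {y} * ((P a).real {y} / outProb π P y - 1) := by
      field_simp; ring
    rw [hr]
    rcases hw.eq_or_lt with h | h
    · simp [← h]
    · exact mul_le_mul_of_nonneg_left (Real.log_le_sub_one_of_pos (by positivity)) (by positivity)

/-- Up to the zero sum `h0`, each summand is at most `P a y` because the posterior probability `π a
* P a y / outProb y` is at most `1`; and `∑ P a y` is the number of inputs. This gives a bound
independent of the output alphabet. -/
theorem channelInfo_chiSq_le (hπ : ∀ a, π {a} ≠ 0) :
    channelInfo .chiSq π P ≤ Fintype.card α := by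
  rw [channelInfo_chiSq_eq, ← ENNReal.ofReal_natCast]
  refine ENNReal.ofReal_le_ofReal ?_
  have h0 : ∑ a, ∑ y, π.real {a} * ((P a).real {y} - outProb π P y) = 0 := by
    rw [Finset.sum_comm]
    exact Finset.sum_eq_zero fun y _ => sum_sub_outProb π P y
  have h1 : ∑ a, ∑ y, (P a).real {y} = Fintype.card α := by
    simp
  rw [← h1, ← add_zero (∑ a, ∑ y, _ * (_ - 1) ^ 2), ← h0, ← Finset.sum_add_distrib]
  refine Finset.sum_le_sum fun a _ => ?_
  rw [← Finset.sum_add_distrib]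
  refine Finset.sum_le_sum fun y _ => ?_
  have hw : 0 ≤ (P a).real {y} := measureReal_nonneg
  have hp : 0 ≤ π.real {a} := measureReal_nonneg
  by_cases hy : outProb π P y = 0
  · simp [hy, outProb_eq_zero_imp π P hπ hy a]
  · have hpos : 0 < outProb π P y := lt_of_le_of_ne (outProb_nonneg π P y) (Ne.symm hy)
    have hr : π.real {a} * outProb π P y * ((P a).real {y} / outProb π P y - 1) ^ 2 +
        π.real {a} * ((P a).real {y} - outProb π P y) =
        (P a).real {y} * ((π.real {a} * (P a).real {y}) / outProb π P y) -
          π.real {a} * (P a).real {y} := by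
      field_simp; ring
    rw [hr]
    have h2 : (π.real {a} * (P a).real {y}) / outProb π P y ≤ 1 :=
      (div_le_one hpos).2 (mul_le_outProb π P a y)
    nlinarith [mul_nonneg hp hw]

theorem channelInfo_kl_le (f : Divergence) (hπ : ∀ a, π {a} ≠ 0) :
    channelInfo .kl π P ≤ channelInfo f π P := by
  cases f with
  | kl => exact le_rfl
  | chiSq => exact channelInfo_kl_le_chiSq π P hπ
  | skl => exact channelInfo_kl_le_skl π P

/-- Zero information means independence, and full support of `π` upgrades this from almost every
input to every input. It handles the case where the denominator of the contraction coefficient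
vanishes. -/
theorem eq_comp_of_channelInfo_eq_zero (f : Divergence) (hπ : ∀ a, π {a} ≠ 0)
    (h : channelInfo f π P = 0) (a : α) : P a = P ∘ₘ π := by
  have h1 : channelInfo .kl π P = 0 :=
    le_antisymm ((channelInfo_kl_le π P f hπ).trans h.le) zero_le
  rw [channelInfo_eq_div] at h1
  have h2 := klDiv_eq_zero_iff.1 h1
  refine Measure.ext_of_singleton fun y => ?_
  have h3 : (π ⊗ₘ P) {(a, y)} = (π.prod (P ∘ₘ π)) {(a, y)} := by rw [h2]
  rw [compProd_singleton, ← Set.singleton_prod_singleton, Measure.prod_prod] at h3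
  exact (ENNReal.mul_right_inj (hπ a) (measure_ne_top _ _)).1 h3

theorem channelInfo_eq_zero_of_const (f : Divergence) {μ : Measure β} [IsProbabilityMeasure μ]
    (h : ∀ a, P a = μ) : channelInfo f π P = 0 := by
  obtain rfl : P = Kernel.const α μ := by ext a : 1; simp [h a]
  rw [channelInfo_eq_div]
  simp [Measure.compProd_const, Divergence.div_self]

end FiniteChannel

/-! ### Data processing -/

/-- Joint and product laws are both pushed forward by the same kernel `id ∥ K`, so data processing
applies to both KL terms. -/
theorem channelInfo_comp_skl_le {α β γ : Type*} [MeasurableSpace α] [MeasurableSpace β]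
    [MeasurableSpace γ] (π : Measure α) [IsProbabilityMeasure π] (P : Kernel α β)
    [IsMarkovKernel P] (K : Kernel β γ) [IsMarkovKernel K] :
    channelInfo .skl π (K ∘ₖ P) ≤ channelInfo .skl π P := by
  have h1 : π ⊗ₘ (K ∘ₖ P) = (Kernel.id ∥ₖ K) ∘ₘ (π ⊗ₘ P) := by
    rw [Measure.parallelComp_comp_compProd]
  have h2 : π.prod ((K ∘ₖ P) ∘ₘ π) = (Kernel.id ∥ₖ K) ∘ₘ (π.prod (P ∘ₘ π)) := by
    rw [← Measure.compProd_const, ← Measure.compProd_const, Measure.parallelComp_comp_compProd]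
    congr 1
    ext a : 1
    rw [Kernel.comp_apply, Kernel.const_apply, Kernel.const_apply, Measure.comp_assoc]
  rw [channelInfo, jointInfo, channelInfo, jointInfo, Measure.fst_compProd, Measure.snd_compProd,
    Measure.fst_compProd, Measure.snd_compProd, h1, h2]
  exact add_le_add (klDiv_comp_right_le _ _ _) (klDiv_comp_right_le _ _ _)

/-! ### Subadditivity over conditionally independent observations -/

section Product

variable {α β γ : Type*} [Fintype α] [MeasurableSpace α] [MeasurableSingletonClass α]
  [Fintype β] [MeasurableSpace β] [MeasurableSingletonClass β]
  [Fintype γ] [MeasurableSpace γ] [MeasurableSingletonClass γ]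
  (π : Measure α) [IsProbabilityMeasure π] (P : Kernel α β) [IsMarkovKernel P]
  (Q : Kernel α γ) [IsMarkovKernel Q]

theorem kernel_prod_real_singleton (a : α) (y : β) (z : γ) :
    ((P ×ₖ Q) a).real {(y, z)} = (P a).real {y} * (Q a).real {z} := by
  rw [Kernel.prod_apply, ← Set.singleton_prod_singleton, measureReal_prod_prod]

/-- Write `I(X; Y, Z) = I(X; Y) + I(X; Z) - I(Y; Z)` for `Y`, `Z` independent given `X`.
Nonnegativity of the last term is obtained from `log x ≤ x - 1` at the ratio of the product of the
output laws to the joint output law `R`. -/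
theorem channelInfo_kl_prod_le (hπ : ∀ a, π {a} ≠ 0) : channelInfo .kl π (P ×ₖ Q) ≤
    channelInfo .kl π P + channelInfo .kl π Q := by
  simp only [channelInfo_kl_eq]
  refine le_trans (ENNReal.ofReal_le_ofReal ?_) ENNReal.ofReal_add_le
  set R := outProb π (P ×ₖ Q)
  have hP : ∀ a, ∑ y, (P a).real {y} = 1 := fun a => sum_real_singleton_eq_one _
  have hQ : ∀ a, ∑ z, (Q a).real {z} = 1 := fun a => sum_real_singleton_eq_one _
  have hterm : ∀ a y z,
      π.real {a} * ((P a).real {y} * (Q a).real {z}) *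
        Real.log ((P a).real {y} * (Q a).real {z} / R (y, z)) ≤
      π.real {a} * (P a).real {y} * Real.log ((P a).real {y} / outProb π P y) *
          (Q a).real {z} +
        π.real {a} * (Q a).real {z} * Real.log ((Q a).real {z} / outProb π Q z) *
          (P a).real {y} +
        (π.real {a} * ((P a).real {y} * (Q a).real {z}) *
          (outProb π P y * outProb π Q z / R (y, z)) -
        π.real {a} * (P a).real {y} * (Q a).real {z}) := by
    intro a y z
    have ha : 0 < π.real {a} := by
      refine lt_of_le_of_ne measureReal_nonneg (Ne.symm ?_)
      rw [ne_eq, measureReal_eq_zero_iff]; exact hπ a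
    have hp : 0 ≤ (P a).real {y} := measureReal_nonneg
    have hq : 0 ≤ (Q a).real {z} := measureReal_nonneg
    rcases hp.eq_or_lt with hp | hp
    · simp [← hp]
    rcases hq.eq_or_lt with hq | hq
    · simp [← hq]
    have h1 : 0 < outProb π P y := (mul_pos ha hp).trans_le (mul_le_outProb π P a y)
    have h2 : 0 < outProb π Q z := (mul_pos ha hq).trans_le (mul_le_outProb π Q a z)
    have h3 : 0 < R (y, z) := by
      refine lt_of_lt_of_le ?_ (mul_le_outProb π (P ×ₖ Q) a (y, z))
      rw [kernel_prod_real_singleton]; positivity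
    have h4 := Real.log_le_sub_one_of_pos
      (show 0 < outProb π P y * outProb π Q z / R (y, z) by positivity)
    have h5 : Real.log ((P a).real {y} * (Q a).real {z} / R (y, z)) =
        Real.log ((P a).real {y} / outProb π P y) + Real.log ((Q a).real {z} / outProb π Q z) +
          Real.log (outProb π P y * outProb π Q z / R (y, z)) := by
      rw [← Real.log_mul (by positivity) (by positivity),
        ← Real.log_mul (by positivity) (by positivity)]
      congr 1
      field_simp
    rw [h5]
    have h6 := mul_le_mul_of_nonneg_left h4
      (show 0 ≤ π.real {a} * ((P a).real {y} * (Q a).real {z}) by positivity)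
    linarith
  have hrest : ∑ a, ∑ y, ∑ z, (π.real {a} * ((P a).real {y} * (Q a).real {z}) *
      (outProb π P y * outProb π Q z / R (y, z)) -
        π.real {a} * (P a).real {y} * (Q a).real {z}) ≤ 0 := by
    have hone : ∑ a, ∑ y, ∑ z, π.real {a} * (P a).real {y} * (Q a).real {z} = 1 := by
      simp_rw [← Finset.mul_sum, hQ, mul_one, ← Finset.mul_sum, hP, mul_one]
      exact sum_real_singleton_eq_one _
    simp_rw [Finset.sum_sub_distrib]
    rw [hone, sub_nonpos]
    calc _ = ∑ y, ∑ z, R (y, z) * (outProb π P y * outProb π Q z / R (y, z)) := by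
          rw [Finset.sum_comm]
          refine Finset.sum_congr rfl fun y _ => ?_
          rw [Finset.sum_comm]
          refine Finset.sum_congr rfl fun z _ => ?_
          have hRyz : R (y, z) = ∑ a, π.real {a} * ((P a).real {y} * (Q a).real {z}) :=
            Finset.sum_congr rfl fun a _ => by rw [kernel_prod_real_singleton]
          rw [← Finset.sum_mul, ← hRyz]
      _ ≤ ∑ y, ∑ z, outProb π P y * outProb π Q z := by
          -- Only an inequality: where `R` vanishes the quotient is `0` by convention, while the
          -- product of output laws may be positive.
          refine Finset.sum_le_sum fun y _ => Finset.sum_le_sum fun z _ => ?_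
          by_cases h : R (y, z) = 0
          · rw [h, zero_mul]
            exact mul_nonneg (outProb_nonneg _ _ _) (outProb_nonneg _ _ _)
          · rw [mul_div_cancel₀ _ h]
      _ = 1 := by
          simp_rw [← Finset.mul_sum, sum_outProb, mul_one]
          exact sum_outProb π P
  calc _ = ∑ a, ∑ y, ∑ z, π.real {a} * ((P a).real {y} * (Q a).real {z}) *
        Real.log ((P a).real {y} * (Q a).real {z} / R (y, z)) := by
        simp_rw [Fintype.sum_prod_type, kernel_prod_real_singleton]
    _ ≤ _ := Finset.sum_le_sum fun a _ => Finset.sum_le_sum fun y _ =>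
        Finset.sum_le_sum fun z _ => hterm a y z
    _ ≤ _ := by
        simp_rw [Finset.sum_add_distrib]
        refine (add_le_of_nonpos_right hrest).trans (le_of_eq ?_)
        simp_rw [← Finset.mul_sum, hQ, mul_one]
        congr 1
        refine Finset.sum_congr rfl fun a _ => ?_
        simp_rw [← Finset.sum_mul, ← Finset.mul_sum, hP, mul_one]

/-- With both informations finite, the supports agree and `channelInfo_skl_eq` applies. The
logarithm of the product channel splits, and summing out the other coordinate leaves the two
marginal expressions, so equality holds in this case. -/
theorem channelInfo_skl_prod_le (hπ : ∀ a, π {a} ≠ 0) : channelInfo .skl π (P ×ₖ Q) ≤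
    channelInfo .skl π P + channelInfo .skl π Q := by
  by_cases hPtop : channelInfo .skl π P = ∞
  · simp [hPtop]
  by_cases hQtop : channelInfo .skl π Q = ∞
  · simp [hQtop]
  have hPs := equalSupport_of_channelInfo_skl π P hπ hPtop
  have hQs := equalSupport_of_channelInfo_skl π Q hπ hQtop
  have hPQs : EqualSupport (P ×ₖ Q) := by
    rintro a b ⟨y, z⟩ h
    rw [kernel_prod_real_singleton] at h ⊢
    rcases mul_eq_zero.1 h with h | h
    · rw [hPs a b y h, zero_mul]
    · rw [hQs a b z h, mul_zero]
  rw [channelInfo_skl_eq _ _ hπ hPs, channelInfo_skl_eq _ _ hπ hQs,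
    channelInfo_skl_eq _ _ hπ hPQs]
  refine le_trans (ENNReal.ofReal_le_ofReal (le_of_eq ?_)) ENNReal.ofReal_add_le
  have hP : ∀ a, ∑ y, (P a).real {y} = 1 := fun a => sum_real_singleton_eq_one _
  have hQ : ∀ a, ∑ z, (Q a).real {z} = 1 := fun a => sum_real_singleton_eq_one _
  have hRQ : ∀ y, ∑ z, outProb π (P ×ₖ Q) (y, z) = outProb π P y := by
    intro y
    simp_rw [outProb, kernel_prod_real_singleton]
    rw [Finset.sum_comm]
    simp_rw [← Finset.mul_sum, hQ, mul_one]
  have hRP : ∀ z, ∑ y, outProb π (P ×ₖ Q) (y, z) = outProb π Q z := by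
    intro z
    simp_rw [outProb, kernel_prod_real_singleton]
    rw [Finset.sum_comm]
    simp_rw [← Finset.mul_sum, ← Finset.sum_mul, hP, one_mul]
  rw [← Finset.sum_add_distrib]
  refine Finset.sum_congr rfl fun a _ => ?_
  have hterm : ∀ y z, π.real {a} * (((P ×ₖ Q) a).real {(y, z)} - outProb π (P ×ₖ Q) (y, z)) *
      Real.log (((P ×ₖ Q) a).real {(y, z)}) =
      π.real {a} * Real.log ((P a).real {y}) *
        ((P a).real {y} * (Q a).real {z} - outProb π (P ×ₖ Q) (y, z)) +
      π.real {a} * Real.log ((Q a).real {z}) *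
        ((P a).real {y} * (Q a).real {z} - outProb π (P ×ₖ Q) (y, z)) := by
    intro y z
    rw [kernel_prod_real_singleton]
    by_cases h : (P a).real {y} * (Q a).real {z} = 0
    · have h0 : outProb π (P ×ₖ Q) (y, z) = 0 :=
        Finset.sum_eq_zero fun b _ => by
          rw [hPQs a b _ (by rw [kernel_prod_real_singleton, h]), mul_zero]
      simp [h, h0]
    · rw [Real.log_mul (left_ne_zero_of_mul h) (right_ne_zero_of_mul h)]
      ring
  rw [Fintype.sum_prod_type]
  simp_rw [hterm, Finset.sum_add_distrib]
  congr 1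
  · refine Finset.sum_congr rfl fun y _ => ?_
    rw [← Finset.mul_sum, Finset.sum_sub_distrib, ← Finset.mul_sum, hQ, hRQ]
    ring
  · rw [Finset.sum_comm]
    refine Finset.sum_congr rfl fun z _ => ?_
    rw [← Finset.mul_sum, Finset.sum_sub_distrib, ← Finset.sum_mul, hP, hRP]
    ring

end Product

/-! ### Binary symmetric channels -/

section Binary

variable {β γ : Type*} [Fintype β] [MeasurableSpace β] [MeasurableSingletonClass β]
  [Fintype γ] [MeasurableSpace γ] [MeasurableSingletonClass γ]

instance : IsProbabilityMeasure unifBinary := by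
  unfold unifBinary
  exact isProbabilityMeasure_uniformOn Set.finite_univ Set.univ_nonempty

theorem unifBinary_real_singleton (a : Fin 2) : unifBinary.real {a} = 1 / 2 := by
  rw [unifBinary, Measure.real, uniformOn_univ]
  simp

theorem outProb_unifBinary (P : Kernel (Fin 2) β) (y : β) :
    outProb unifBinary P y = ((P 0).real {y} + (P 1).real {y}) / 2 := by
  rw [outProb, Fin.sum_univ_two, unifBinary_real_singleton, unifBinary_real_singleton]
  ring

theorem IsBMSWith.real_singleton {P : Kernel (Fin 2) β} {s : β → β} (h : IsBMSWith P s) (y : β) :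
    (P 0).real {y} = (P 1).real {s y} := by
  rw [Measure.real, h.2.2 _ (measurableSet_singleton y), Set.image_singleton, Measure.real]

theorem IsBMSWith.real_singleton' {P : Kernel (Fin 2) β} {s : β → β} (h : IsBMSWith P s) (y : β) :
    (P 1).real {y} = (P 0).real {s y} := by
  rw [h.real_singleton, h.2.1]

theorem capacity_chiSq_eq (P : Kernel (Fin 2) β) [IsMarkovKernel P] :
    channelInfo .chiSq unifBinary P = ENNReal.ofReal
      (∑ y, ((P 0).real {y} - (P 1).real {y}) ^ 2 / (2 * ((P 0).real {y} + (P 1).real {y}))) := by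
  rw [channelInfo_chiSq_eq, Fin.sum_univ_two, ← Finset.sum_add_distrib]
  congr 1
  refine Finset.sum_congr rfl fun y _ => ?_
  rw [outProb_unifBinary, unifBinary_real_singleton, unifBinary_real_singleton]
  by_cases h : (P 0).real {y} + (P 1).real {y} = 0
  · simp [h]
  · field_simp
    ring

/-- With `u = (a - b) / (a + b)` and `w = (c - d) / (c + d)`, the claim reduces to `u² w² (u² + w²)
≤ 2 u² w²`, true since `|u|, |w| ≤ 1`. This is `hN` multiplied by a square; the preceding cases deal
with vanishing denominators. -/
theorem chiSq_prod_pointwise {a b c d : ℝ} (ha : 0 ≤ a) (hb : 0 ≤ b) (hc : 0 ≤ c) (hd : 0 ≤ d) :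
    (a * c - b * d) ^ 2 / (2 * (a * c + b * d)) + (a * d - b * c) ^ 2 / (2 * (a * d + b * c)) ≤
      (a - b) ^ 2 / (2 * (a + b)) * (c + d) + (c - d) ^ 2 / (2 * (c + d)) * (a + b) := by
  rcases (add_nonneg ha hb).eq_or_lt with hA | hA
  · obtain rfl : a = 0 := by linarith
    obtain rfl : b = 0 := by linarith
    simp
  rcases (add_nonneg hc hd).eq_or_lt with hC | hC
  · obtain rfl : c = 0 := by linarith
    obtain rfl : d = 0 := by linarith
    simp
  have hp : 0 < (a + b) * (c + d) := mul_pos hA hC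
  have hac := mul_nonneg ha hc
  have hbd := mul_nonneg hb hd
  have had := mul_nonneg ha hd
  have hbc := mul_nonneg hb hc
  have hrhs : (a - b) ^ 2 / (2 * (a + b)) * (c + d) + (c - d) ^ 2 / (2 * (c + d)) * (a + b) =
      (((a - b) * (c + d)) ^ 2 + ((c - d) * (a + b)) ^ 2) / (2 * ((a + b) * (c + d))) := by
    field_simp
  rw [hrhs]
  rcases (add_nonneg hac hbd).eq_or_lt with h | h
  · have h1 : a * c = 0 := by linarith
    have h2 : b * d = 0 := by linarith
    rw [← h, h1, h2, mul_zero, div_zero, zero_add, div_le_div_iff₀ (by nlinarith) (by positivity)]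
    have h3 : (a + b) * (c + d) = a * d + b * c := by linear_combination h1 + h2
    rw [h3]
    have h4 : ((a - b) * (c + d)) ^ 2 + ((c - d) * (a + b)) ^ 2 = 2 * (a * d - b * c) ^ 2 := by
      linear_combination (2 * a * c - 4 * b * d) * h1 + 2 * b * d * h2
    rw [h4]
    have h5 : 0 ≤ a * d + b * c := by positivity
    nlinarith [mul_nonneg (sq_nonneg (a * d - b * c)) h5]
  rcases (add_nonneg had hbc).eq_or_lt with h' | h'
  · have h1 : a * d = 0 := by linarith
    have h2 : b * c = 0 := by linarith
    rw [← h', h1, h2, mul_zero, div_zero, add_zero, div_le_div_iff₀ (by positivity) (by positivity)]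
    have h3 : (a + b) * (c + d) = a * c + b * d := by linear_combination h1 + h2
    rw [h3]
    have h4 : ((a - b) * (c + d)) ^ 2 + ((c - d) * (a + b)) ^ 2 = 2 * (a * c - b * d) ^ 2 := by
      linear_combination (2 * a * d - 4 * b * c) * h1 + 2 * b * c * h2
    rw [h4]
    nlinarith [mul_nonneg (sq_nonneg (a * c - b * d)) h.le]
  have hN : ((a - b) * (c + d)) ^ 2 + ((c - d) * (a + b)) ^ 2 ≤ 2 * ((a + b) * (c + d)) ^ 2 := by
    have h1 : (a - b) ^ 2 ≤ (a + b) ^ 2 := by nlinarith [mul_nonneg ha hb]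
    have h2 : (c - d) ^ 2 ≤ (c + d) ^ 2 := by nlinarith [mul_nonneg hc hd]
    have h3 := mul_le_mul_of_nonneg_right h1 (sq_nonneg (c + d))
    have h4 := mul_le_mul_of_nonneg_right h2 (sq_nonneg (a + b))
    nlinarith
  rw [div_add_div _ _ (by positivity) (by positivity), div_le_div_iff₀ (by positivity)
    (by positivity)]
  have hmul := mul_nonneg (sub_nonneg.2 hN) (sq_nonneg ((a - b) * (c - d)))
  linarith [hmul]

/-- The involution of `Q` exchanges its two output laws. Pairing `z` with `s z` therefore pairs `(c,
d)` with `(d, c)`, and the inequality holds for each such pair of terms though it is not claimed for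
single terms. -/
theorem capacity_chiSq_prod_le (P : Kernel (Fin 2) β) [IsMarkovKernel P]
    (Q : Kernel (Fin 2) γ) [IsMarkovKernel Q] (hQ : IsBMS Q) :
    channelInfo .chiSq unifBinary (P ×ₖ Q) ≤
      channelInfo .chiSq unifBinary P + channelInfo .chiSq unifBinary Q := by
  obtain ⟨s, hs⟩ := hQ
  simp only [capacity_chiSq_eq]
  refine le_trans (ENNReal.ofReal_le_ofReal ?_) ENNReal.ofReal_add_le
  set e : γ ≃ γ := hs.2.1.toPerm with he
  have hP1 : ∀ a, ∑ y, (P a).real {y} = 1 := fun a => sum_real_singleton_eq_one _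
  have hQ1 : ∀ a, ∑ z, (Q a).real {z} = 1 := fun a => sum_real_singleton_eq_one _
  simp_rw [Fintype.sum_prod_type, kernel_prod_real_singleton]
  set F : β → γ → ℝ := fun y z =>
    ((P 0).real {y} * (Q 0).real {z} - (P 1).real {y} * (Q 1).real {z}) ^ 2 /
      (2 * ((P 0).real {y} * (Q 0).real {z} + (P 1).real {y} * (Q 1).real {z})) with hF
  have hsymm : ∀ y, ∑ z, F y (s z) = ∑ z, F y z := fun y => Equiv.sum_comp e (F y)
  have h2 : 2 * ∑ y, ∑ z, F y z = ∑ y, ∑ z, (F y z + F y (s z)) := by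
    simp_rw [Finset.sum_add_distrib, hsymm]; ring
  have h3 : ∑ y, ∑ z, (F y z + F y (s z)) ≤ ∑ y, ∑ z,
      (((P 0).real {y} - (P 1).real {y}) ^ 2 / (2 * ((P 0).real {y} + (P 1).real {y})) *
        ((Q 0).real {z} + (Q 1).real {z}) +
      ((Q 0).real {z} - (Q 1).real {z}) ^ 2 / (2 * ((Q 0).real {z} + (Q 1).real {z})) *
        ((P 0).real {y} + (P 1).real {y})) := by
    refine Finset.sum_le_sum fun y _ => Finset.sum_le_sum fun z _ => ?_
    rw [hF]
    dsimp only
    rw [← hs.real_singleton, ← hs.real_singleton']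
    exact chiSq_prod_pointwise measureReal_nonneg measureReal_nonneg measureReal_nonneg
      measureReal_nonneg
  have h4 : ∑ y, ∑ z,
      (((P 0).real {y} - (P 1).real {y}) ^ 2 / (2 * ((P 0).real {y} + (P 1).real {y})) *
        ((Q 0).real {z} + (Q 1).real {z}) +
      ((Q 0).real {z} - (Q 1).real {z}) ^ 2 / (2 * ((Q 0).real {z} + (Q 1).real {z})) *
        ((P 0).real {y} + (P 1).real {y})) =
      2 * (∑ y, ((P 0).real {y} - (P 1).real {y}) ^ 2 / (2 * ((P 0).real {y} + (P 1).real {y}))) +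
      2 * (∑ z, ((Q 0).real {z} - (Q 1).real {z}) ^ 2 /
        (2 * ((Q 0).real {z} + (Q 1).real {z}))) := by
    simp_rw [Finset.sum_add_distrib, ← Finset.mul_sum, Finset.sum_add_distrib, hQ1,
      ← Finset.sum_mul, ← Finset.mul_sum, Finset.sum_add_distrib, hP1]
    ring
  linarith

end Binary

/-! ### Tensor products of channels -/

section Tensor

variable {q n : ℕ} {Y : Fin n → Type*} [∀ i, Fintype (Y i)] [∀ i, MeasurableSpace (Y i)]
  [∀ i, MeasurableSingletonClass (Y i)]

theorem tensorChannel_apply (P : ∀ i, Kernel (Fin q) (Y i)) (x : Fin n → Fin q) :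
    tensorChannel P x = Measure.pi fun i => P i (x i) := rfl

instance (P : ∀ i, Kernel (Fin q) (Y i)) [∀ i, IsMarkovKernel (P i)] :
    IsMarkovKernel (tensorChannel P) :=
  ⟨fun x => by rw [tensorChannel_apply]; infer_instance⟩

theorem tensorChannel_comp_singleton (P : ∀ i, Kernel (Fin q) (Y i)) [∀ i, IsMarkovKernel (P i)]
    (B : Kernel (Fin q) (Fin n → Fin q)) (a : Fin q) (y : ∀ i, Y i) :
    (tensorChannel P ∘ₖ B) a {y} = ∑ z, B a {z} * ∏ i, P i (z i) {y i} := by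
  rw [Kernel.comp_apply' _ _ _ (measurableSet_singleton y), lintegral_fintype]
  refine Finset.sum_congr rfl fun z _ => ?_
  rw [tensorChannel_apply, Measure.pi_singleton, mul_comm]

end Tensor

/-! ### Symmetric channels -/

section Symmetric

variable {Y Z : Type*} [Fintype Y] [MeasurableSpace Y] [MeasurableSingletonClass Y]
  [Fintype Z] [MeasurableSpace Z] [MeasurableSingletonClass Z]

theorem isBMSWith_of_singleton {P : Kernel (Fin 2) Y} {s : Y → Y} (hs : Function.Involutive s)
    (h : ∀ y, P 0 {y} = P 1 {s y}) : IsBMSWith P s := by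
  have hm : Measurable s := measurable_of_finite s
  have himg : ∀ E : Set Y, s '' E = s ⁻¹' E := fun E => by
    rw [Set.image_eq_preimage_of_inverse hs.leftInverse hs.rightInverse]
  have hmap : P 0 = (P 1).map s := Measure.ext_of_singleton fun y => by
    rw [Measure.map_apply hm (measurableSet_singleton y), ← himg, Set.image_singleton, h]
  refine ⟨hm, hs, fun E hE => ?_⟩
  rw [himg, ← Measure.map_apply hm hE, hmap]

theorem IsBMSWith.singleton {P : Kernel (Fin 2) Y} {s : Y → Y} (h : IsBMSWith P s) (y : Y) :
    P 0 {y} = P 1 {s y} := by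
  rw [h.2.2 _ (measurableSet_singleton y), Set.image_singleton]

theorem IsBMSWith.singleton_swap {P : Kernel (Fin 2) Y} {s : Y → Y} (h : IsBMSWith P s)
    (a : Fin 2) (y : Y) : P (Equiv.swap 0 1 a) {s y} = P a {y} := by
  fin_cases a
  · simpa using (h.singleton y).symm
  · simpa [h.2.1 y] using h.singleton (s y)

theorem isBMS_id : IsBMS (Kernel.id : Kernel (Fin 2) (Fin 2)) := by
  refine ⟨Equiv.swap 0 1, isBMSWith_of_singleton (fun y => by simp) fun y => ?_⟩
  fin_cases y <;> simp [Kernel.id_apply]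

theorem isBMS_const (μ : Measure Y) : IsBMS (Kernel.const (Fin 2) μ) :=
  ⟨id, isBMSWith_of_singleton (fun _ => rfl) fun _ => by simp⟩

theorem IsBMS.prod {P : Kernel (Fin 2) Y} {Q : Kernel (Fin 2) Z} [IsMarkovKernel P]
    [IsMarkovKernel Q] (hP : IsBMS P) (hQ : IsBMS Q) : IsBMS (P ×ₖ Q) := by
  obtain ⟨s, hs⟩ := hP
  obtain ⟨t, ht⟩ := hQ
  refine ⟨Prod.map s t, isBMSWith_of_singleton (fun y => ?_) fun y => ?_⟩
  · simp [Prod.map, hs.2.1 y.1, ht.2.1 y.2]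
  · obtain ⟨y, z⟩ := y
    rw [Prod.map_apply, Kernel.prod_apply, Kernel.prod_apply, ← Set.singleton_prod_singleton,
      ← Set.singleton_prod_singleton, Measure.prod_prod, Measure.prod_prod, hs.singleton,
      ht.singleton]

theorem signFlip_involutive {n : ℕ} : Function.Involutive (signFlip (n := n)) := fun x => by
  funext i; simp [signFlip]

theorem isBMS_tensorChannel_comp {n : ℕ} {Y : Fin n → Type*} [∀ i, Fintype (Y i)]
    [∀ i, MeasurableSpace (Y i)] [∀ i, MeasurableSingletonClass (Y i)]
    (P : ∀ i, Kernel (Fin 2) (Y i)) [∀ i, IsMarkovKernel (P i)] (hP : ∀ i, IsBMS (P i))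
    {B : Kernel (Fin 2) (Fin n → Fin 2)} (hB : IsBMSWith B signFlip) :
    IsBMS (tensorChannel P ∘ₖ B) := by
  choose s hs using hP
  refine ⟨fun y i => s i (y i), isBMSWith_of_singleton
    (fun y => funext fun i => (hs i).2.1 (y i)) fun y => ?_⟩
  rw [tensorChannel_comp_singleton, tensorChannel_comp_singleton,
    -- Reindex the intermediate labels by the sign flip: `B` and every `P i` are unchanged when
    -- input and output are flipped together.
    ← Equiv.sum_comp (signFlip_involutive (n := n)).toPerm]
  refine Finset.sum_congr rfl fun z _ => ?_
  rw [Function.Involutive.coe_toPerm, hB.singleton, signFlip_involutive z]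
  congr 1
  refine Finset.prod_congr rfl fun i _ => ?_
  rw [← (hs i).singleton_swap (signFlip z i) (y i)]
  simp [signFlip]

end Symmetric

/-! ### Channels between the label of a vertex and observed labels below it -/

attribute [instance] Params.isProbabilityMeasure Params.isMarkovKernel

/-- A channel with finite output alphabet, together with a map reading off the output from a
labelling of the vertices. -/
structure ObsChannel (V : Type*) (q : ℕ) where
  Y : Type
  [fintype : Fintype Y]
  [measurableSpace : MeasurableSpace Y]
  [measurableSingletonClass : MeasurableSingletonClass Y]
  kernel : Kernel (Fin q) Y
  [isMarkovKernel : IsMarkovKernel kernel]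
  obs : (V → Fin q) → Y

namespace ObsChannel

attribute [instance] ObsChannel.fintype ObsChannel.measurableSpace
  ObsChannel.measurableSingletonClass ObsChannel.isMarkovKernel

variable {V : Type*} {q r : ℕ}

/-- The label of a vertex is observed. -/
noncomputable def ident (v : V) : ObsChannel V q where
  Y := Fin q
  kernel := Kernel.id
  obs x := x v

/-- Nothing is observed. -/
noncomputable def unit : ObsChannel V q where
  Y := Unit
  kernel := Kernel.const _ (Measure.dirac ())
  obs _ := ()

/-- Two conditionally independent observations. -/
noncomputable def prod (c d : ObsChannel V q) : ObsChannel V q where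
  Y := c.Y × d.Y
  kernel := c.kernel ×ₖ d.kernel
  obs x := (c.obs x, d.obs x)

/-- The observation, through a hyperedge, of independent observations of its lower vertices. -/
noncomputable def node (M : Params q r) (c : Fin (r - 1) → ObsChannel V q) : ObsChannel V q where
  Y := ∀ i, (c i).Y
  kernel := tensorChannel (fun i => (c i).kernel) ∘ₖ M.B
  obs x i := (c i).obs x

/-- Finitely many conditionally independent observations. -/
noncomputable def prodList (l : List (ObsChannel V q)) : ObsChannel V q := l.foldr prod unit

/-- The information carried by an observation. -/
noncomputable def info (f : Divergence) (π : Measure (Fin q)) (c : ObsChannel V q) : ℝ≥0∞ :=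
  channelInfo f π c.kernel

/-- The likelihood of the input `a` given the observation of the labelling `x`. -/
noncomputable def mass (c : ObsChannel V q) (x : V → Fin q) (a : Fin q) : ℝ≥0∞ :=
  c.kernel a {c.obs x}

theorem mass_ident (v : V) (x : V → Fin q) (a : Fin q) :
    (ident v).mass x a = if a = x v then 1 else 0 := by
  change (Kernel.id : Kernel (Fin q) (Fin q)) a {x v} = _
  rw [Kernel.id_apply, Measure.dirac_apply' _ (measurableSet_singleton _)]
  simp [Set.indicator_apply]

theorem mass_prodList (l : List (ObsChannel V q)) (x : V → Fin q) (a : Fin q) :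
    (prodList l).mass x a = (l.map fun c => c.mass x a).prod := by
  induction l with
  | nil =>
    change (Kernel.const (Fin q) (Measure.dirac ())) a {()} = _
    simp
  | cons c l ih =>
    rw [List.map_cons, List.prod_cons, ← ih]
    change (c.kernel ×ₖ (prodList l).kernel) a {(c.obs x, (prodList l).obs x)} = _
    rw [Kernel.prod_apply, ← Set.singleton_prod_singleton, Measure.prod_prod]
    rfl

theorem mass_node (M : Params q r) (c : Fin (r - 1) → ObsChannel V q) (x : V → Fin q)
    (a : Fin q) : (node M c).mass x a = ∑ z, M.B a {z} * ∏ i, (c i).mass x (z i) :=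
  tensorChannel_comp_singleton _ _ _ _

theorem info_unit (f : Divergence) (π : Measure (Fin q)) [IsProbabilityMeasure π] :
    (unit : ObsChannel V q).info f π = 0 :=
  channelInfo_eq_zero_of_const π (Kernel.const (Fin q) (Measure.dirac ())) f
    (fun a => Kernel.const_apply _ a)

/-- A class of observations, containing all those arising from the broadcasting process, on which
`f`-information is subadditive and contracts by a factor `η` through a hyperedge. -/
structure IsContractive (f : Divergence) (M : Params q r) (η : ℝ≥0∞)
    (G : ObsChannel V q → Prop) : Prop where
  ident : ∀ v, G (ident v)
  unit : G unit
  prod : ∀ c d, G c → G d → G (prod c d)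
  node : ∀ c, (∀ i, G (c i)) → G (node M c)
  info_prod_le : ∀ c d, G c → G d →
    (ObsChannel.prod c d).info f M.π ≤ c.info f M.π + d.info f M.π
  info_node_le : ∀ c, (∀ i, G (c i)) → ∑ i, (c i).info f M.π < ∞ →
    (ObsChannel.node M c).info f M.π ≤ η * ∑ i, (c i).info f M.π

section Contractive

variable {f : Divergence} {M : Params q r} {η : ℝ≥0∞} {G : ObsChannel V q → Prop}

theorem IsContractive.prodList (h : IsContractive f M η G) (l : List (ObsChannel V q))
    (hl : ∀ c ∈ l, G c) : G (prodList l) := by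
  induction l with
  | nil => exact h.unit
  | cons c l ih =>
    exact h.prod _ _ (hl c List.mem_cons_self) (ih fun d hd => hl d (List.mem_cons_of_mem _ hd))

theorem IsContractive.info_prodList_le (h : IsContractive f M η G) (l : List (ObsChannel V q))
    (hl : ∀ c ∈ l, G c) :
    (ObsChannel.prodList l).info f M.π ≤ (l.map fun c => c.info f M.π).sum := by
  induction l with
  | nil => simp [ObsChannel.prodList, info_unit]
  | cons c l ih =>
    have hl' : ∀ d ∈ l, G d := fun d hd => hl d (List.mem_cons_of_mem _ hd)
    rw [List.map_cons, List.sum_cons]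
    exact (h.info_prod_le _ _ (hl c List.mem_cons_self) (h.prodList l hl')).trans
      (add_le_add_right (ih hl') _)

end Contractive

theorem info_node_eq_zero (f : Divergence) (M : Params q r) (c : Fin (r - 1) → ObsChannel V q)
    (h : ∀ i, (c i).info f M.π = 0) : (node M c).info f M.π = 0 := by
  refine channelInfo_eq_zero_of_const M.π (tensorChannel (fun i => (c i).kernel) ∘ₖ M.B) f
    (μ := Measure.pi fun i => (c i).kernel ∘ₘ M.π) fun a => ?_
  have hc : tensorChannel (fun i => (c i).kernel) =
      Kernel.const _ (Measure.pi fun i => (c i).kernel ∘ₘ M.π) := by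
    ext x : 1
    rw [tensorChannel_apply, Kernel.const_apply]
    congr 1
    funext i
    exact eq_comp_of_channelInfo_eq_zero _ _ f M.full_support (h i) (x i)
  rw [hc, Kernel.comp_apply]
  simp

/-- The supremum covers only tuples of positive total information; when the total is zero,
`info_node_eq_zero` makes the left side zero. Output alphabets in `ObsChannel` live in `Type`, as in
the supremum. -/
theorem info_node_le_etaHet (f : Divergence) (M : Params q r) (c : Fin (r - 1) → ObsChannel V q)
    (hc : ∑ i, (c i).info f M.π < ∞) :
    (node M c).info f M.π ≤ etaHet f M * ∑ i, (c i).info f M.π := by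
  rcases eq_or_ne (∑ i, (c i).info f M.π) 0 with h0 | h0
  · rw [info_node_eq_zero f M c fun i => (Finset.sum_eq_zero_iff.1 h0) i (Finset.mem_univ i)]
    exact zero_le
  · rw [← ENNReal.div_le_iff h0 hc.ne]
    exact le_iSup_of_le (fun i => (c i).Y) <| le_iSup_of_le (fun i => (c i).measurableSpace) <|
      le_iSup_of_le (fun i => (c i).kernel) <| le_iSup_of_le (fun i => (c i).isMarkovKernel) <|
      le_iSup_of_le (pos_iff_ne_zero.2 h0) <| le_iSup_of_le hc le_rfl

theorem info_node_le_etaHetSymm (f : Divergence) (M : Params 2 r) (hM : M.IsBinarySymmetric)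
    (c : Fin (r - 1) → ObsChannel V 2) (hs : ∀ i, IsBMS (c i).kernel)
    (hc : ∑ i, (c i).info f M.π < ∞) :
    (node M c).info f M.π ≤ etaHetSymm f M * ∑ i, (c i).info f M.π := by
  rcases eq_or_ne (∑ i, (c i).info f M.π) 0 with h0 | h0
  · rw [info_node_eq_zero f M c fun i => (Finset.sum_eq_zero_iff.1 h0) i (Finset.mem_univ i)]
    exact zero_le
  · rw [← ENNReal.div_le_iff h0 hc.ne]
    rw [hM.1] at h0 hc ⊢
    exact le_iSup_of_le (fun i => (c i).Y) <| le_iSup_of_le (fun i => (c i).measurableSpace) <|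
      le_iSup_of_le (fun i => (c i).kernel) <| le_iSup_of_le (fun i => (c i).isMarkovKernel) <|
      le_iSup_of_le hs <| le_iSup_of_le (pos_iff_ne_zero.2 h0) <| le_iSup_of_le hc le_rfl

theorem isContractive_etaHet {f : Divergence} (hf : f = .kl ∨ f = .skl) (M : Params q r) :
    IsContractive (V := V) f M (etaHet f M) fun _ => True where
  ident _ := trivial
  unit := trivial
  prod _ _ _ _ := trivial
  node _ _ := trivial
  info_prod_le c d _ _ := by
    rcases hf with rfl | rfl
    · exact channelInfo_kl_prod_le _ _ _ M.full_support
    · exact channelInfo_skl_prod_le _ _ _ M.full_support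
  info_node_le c _ := info_node_le_etaHet f M c

theorem isContractive_etaHetSymm (f : Divergence) (M : Params 2 r) (hM : M.IsBinarySymmetric) :
    IsContractive (V := V) f M (etaHetSymm f M) fun c => IsBMS c.kernel where
  ident _ := isBMS_id
  unit := isBMS_const _
  prod _ _ hc hd := hc.prod hd
  node c hc := isBMS_tensorChannel_comp _ hc hM.2
  info_prod_le c d _ hd := by
    cases f with
    | kl => exact channelInfo_kl_prod_le _ _ _ M.full_support
    | skl => exact channelInfo_skl_prod_le _ _ _ M.full_support
    | chiSq => rw [hM.1]; exact capacity_chiSq_prod_le _ _ hd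
  info_node_le c hc := info_node_le_etaHetSymm f M hM c hc

end ObsChannel

namespace RootedHypertree

variable {r : ℕ} {V E : Type*} {T : RootedHypertree r V E} {q : ℕ}

/-! ### Finiteness -/

theorem LocallyFinite.finite_top (hT : T.LocallyFinite) (v : V) : {e | T.top e = v}.Finite :=
  (hT v).subset fun e he => by
    rw [Set.mem_ofPred_eq] at he
    exact he ▸ Set.mem_insert _ _

/-- The downward hyperedges of a vertex. -/
noncomputable def LocallyFinite.downEdges (hT : T.LocallyFinite) (v : V) : Finset E :=
  (hT.finite_top v).toFinset

@[simp]
theorem LocallyFinite.mem_downEdges (hT : T.LocallyFinite) {v : V} {e : E} :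
    e ∈ hT.downEdges v ↔ T.top e = v := by
  simp [LocallyFinite.downEdges]

theorem depth_eq_zero_iff {v : V} : T.depth v = 0 ↔ v = T.root := by
  refine ⟨fun h => ?_, fun h => h ▸ T.depth_root⟩
  by_contra hv
  obtain ⟨e, i, rfl⟩ := T.exists_child v hv
  rw [T.depth_child] at h
  omega

theorem exists_child_of_depth {v : V} {k : ℕ} (h : T.depth v = k + 1) :
    ∃ e i, T.depth (T.top e) = k ∧ T.child e i = v := by
  obtain ⟨e, i, rfl⟩ := T.exists_child v fun hv => by rw [hv, T.depth_root] at h; omega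
  rw [T.depth_child] at h
  exact ⟨e, i, by omega, rfl⟩

theorem LocallyFinite.finite_ball (hT : T.LocallyFinite) (k : ℕ) : {v | T.depth v ≤ k}.Finite := by
  induction k with
  | zero =>
    refine (Set.finite_singleton T.root).subset fun v hv => ?_
    exact depth_eq_zero_iff.1 (Nat.le_zero.1 hv)
  | succ k ih =>
    refine (ih.union (ih.biUnion fun v _ => (hT.finite_top v).biUnion fun e _ =>
      Set.finite_range (T.child e))).subset fun v hv => ?_
    rcases Nat.le_succ_iff.1 hv with h | h
    · exact Or.inl h
    · obtain ⟨e, i, he, rfl⟩ := exists_child_of_depth h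
      refine Or.inr ?_
      simp only [Set.mem_iUnion]
      exact ⟨T.top e, he.le, e, rfl, i, rfl⟩

theorem LocallyFinite.finite_Ball (hT : T.LocallyFinite) (k : ℕ) : Finite (T.Ball k) :=
  (hT.finite_ball k).to_subtype

theorem LocallyFinite.finite_Level (hT : T.LocallyFinite) (k : ℕ) : Finite (T.Level k) :=
  ((hT.finite_ball k).subset fun _ hv => le_of_eq hv).to_subtype

theorem LocallyFinite.finite_BallEdge (hT : T.LocallyFinite) (k : ℕ) : Finite (T.BallEdge k) := by
  refine Set.Finite.to_subtype (((hT.finite_ball k).biUnion fun v _ => hT.finite_top v).subset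
    fun e he => ?_)
  simp only [Set.mem_iUnion]
  exact ⟨T.top e, (Nat.le_succ _).trans he, rfl⟩

variable (T) in
/-- The hyperedges whose top vertex is at distance `k` from the root. -/
abbrev LevelEdge (k : ℕ) : Type _ := {e : E // T.depth (T.top e) = k}

theorem LocallyFinite.finite_LevelEdge (hT : T.LocallyFinite) (k : ℕ) :
    Finite (T.LevelEdge k) := by
  refine Set.Finite.to_subtype (((hT.finite_ball k).biUnion fun v _ => hT.finite_top v).subset
    fun e he => ?_)
  simp only [Set.mem_iUnion]
  exact ⟨T.top e, le_of_eq he, rfl⟩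

/-! ### Growing a ball by one level -/

variable (T) in
/-- The vertices of a ball are those of the ball of one step smaller radius and the lower vertices
of the new hyperedges. -/
noncomputable def ballSuccEquiv (k : ℕ) :
    T.Ball k ⊕ (T.LevelEdge k × Fin (r - 1)) ≃ T.Ball (k + 1) :=
  Equiv.ofBijective
    (Sum.elim (fun v => ⟨v.1, v.2.trans (Nat.le_succ k)⟩)
      (fun p => ⟨T.child p.1.1 p.2, by rw [T.depth_child, p.1.2]⟩)) <| by
    constructor
    · rintro (⟨v, hv⟩ | ⟨⟨e, he⟩, i⟩) (⟨v', hv'⟩ | ⟨⟨e', he'⟩, i'⟩) h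
      · simpa using h
      · simp only [Sum.elim_inl, Sum.elim_inr, Subtype.mk.injEq] at h
        rw [h, T.depth_child, he'] at hv
        omega
      · simp only [Sum.elim_inl, Sum.elim_inr, Subtype.mk.injEq] at h
        rw [← h, T.depth_child, he] at hv'
        omega
      · simp only [Sum.elim_inr, Subtype.mk.injEq] at h
        obtain ⟨rfl, rfl⟩ := T.child_inj _ _ _ _ h
        rfl
    · rintro ⟨v, hv⟩
      rcases Nat.le_succ_iff.1 hv with h | h
      · exact ⟨Sum.inl ⟨v, h⟩, rfl⟩
      · obtain ⟨e, i, he, rfl⟩ := exists_child_of_depth h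
        exact ⟨Sum.inr (⟨e, he⟩, i), rfl⟩

variable (T) in
/-- A labelling of a ball and labels for the lower vertices of the new hyperedges form a labelling
of the next ball. -/
noncomputable def labelSuccEquiv (q k : ℕ) :
    (T.Ball k → Fin q) × (T.LevelEdge k → Fin (r - 1) → Fin q) ≃ (T.Ball (k + 1) → Fin q) :=
  ((Equiv.prodCongr (Equiv.refl _) (Equiv.curry _ _ _).symm).trans
    (Equiv.sumArrowEquivProdArrow _ _ _).symm).trans
    (Equiv.arrowCongr (T.ballSuccEquiv k) (Equiv.refl _))

theorem labelSuccEquiv_of_le {k : ℕ} (p : (T.Ball k → Fin q) × (T.LevelEdge k → _ → Fin q))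
    {v : V} (hv : T.depth v ≤ k) (hv' : T.depth v ≤ k + 1) :
    T.labelSuccEquiv q k p ⟨v, hv'⟩ = p.1 ⟨v, hv⟩ := by
  have : (⟨v, hv'⟩ : T.Ball (k + 1)) = T.ballSuccEquiv k (Sum.inl ⟨v, hv⟩) := rfl
  rw [this]
  simp [labelSuccEquiv, Equiv.arrowCongr, Equiv.sumArrowEquivProdArrow]

theorem labelSuccEquiv_child {k : ℕ} (p : (T.Ball k → Fin q) × (T.LevelEdge k → _ → Fin q))
    (e : T.LevelEdge k) (i : Fin (r - 1)) (h : T.depth (T.child e.1 i) ≤ k + 1) :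
    T.labelSuccEquiv q k p ⟨T.child e.1 i, h⟩ = p.2 e i := by
  have : (⟨T.child e.1 i, h⟩ : T.Ball (k + 1)) = T.ballSuccEquiv k (Sum.inr (e, i)) := rfl
  rw [this]
  simp [labelSuccEquiv, Equiv.arrowCongr, Equiv.sumArrowEquivProdArrow, Equiv.curry]

/-- The top vertex of a hyperedge, as a vertex of the ball. -/
def LevelEdge.top {k : ℕ} (e : T.LevelEdge k) : T.Ball k := ⟨T.top e.1, e.2.le⟩

theorem labelProb_succ (hT : T.LocallyFinite) (M : Params q r) (k : ℕ)
    (p : (T.Ball k → Fin q) × (T.LevelEdge k → _ → Fin q)) :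
    T.labelProb M (k + 1) (T.labelSuccEquiv q k p) =
      T.labelProb M k p.1 * ∏ᶠ e : T.LevelEdge k, M.B (p.1 (LevelEdge.top e)) {p.2 e} := by
  have := hT.finite_BallEdge k
  have := hT.finite_BallEdge (k + 1)
  have := hT.finite_LevelEdge k
  have := Fintype.ofFinite (T.BallEdge k)
  have := Fintype.ofFinite (T.BallEdge (k + 1))
  have := Fintype.ofFinite (T.LevelEdge k)
  have hroot : T.labelSuccEquiv q k p (T.ballRoot (k + 1)) = p.1 (T.ballRoot k) :=
    labelSuccEquiv_of_le _ _ _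
  rw [labelProb, labelProb, hroot, mul_assoc]
  congr 1
  simp only [finprod_eq_prod_of_fintype]
  have hbij : Function.Bijective (Sum.elim (fun e => ⟨e.1, e.2.trans (Nat.le_succ k)⟩)
      (fun e => ⟨e.1, by rw [e.2]⟩) : T.BallEdge k ⊕ T.LevelEdge k → T.BallEdge (k + 1)) := by
    constructor
    · rintro (⟨e, he⟩ | ⟨e, he⟩) (⟨e', he'⟩ | ⟨e', he'⟩) h <;>
        simp only [Sum.elim_inl, Sum.elim_inr, Subtype.mk.injEq] at h <;> subst h
      · rfl
      · omega
      · omega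
      · rfl
    · rintro ⟨e, he⟩
      rcases Nat.le_succ_iff.1 he with h | h
      · exact ⟨Sum.inl ⟨e, h⟩, rfl⟩
      · exact ⟨Sum.inr ⟨e, by omega⟩, rfl⟩
  rw [← Fintype.prod_bijective _ hbij _ _ fun _ => rfl, Fintype.prod_sum_type]
  congr 1
  · refine Fintype.prod_congr _ _ fun e => ?_
    have h1 : T.labelSuccEquiv q k p (T.ballTop ⟨e.1, e.2.trans (Nat.le_succ k)⟩) =
        p.1 (T.ballTop e) := labelSuccEquiv_of_le _ _ _
    have h2 : ∀ i, T.labelSuccEquiv q k p (T.ballChild ⟨e.1, e.2.trans (Nat.le_succ k)⟩ i) =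
        p.1 (T.ballChild e i) := fun i => labelSuccEquiv_of_le _ _ _
    simp only [Sum.elim_inl, h1, h2]
  · refine Fintype.prod_congr _ _ fun e => ?_
    have h1 : T.labelSuccEquiv q k p (T.ballTop ⟨e.1, by rw [e.2]⟩) =
        p.1 (LevelEdge.top e) := labelSuccEquiv_of_le _ _ _
    have h2 : ∀ i, T.labelSuccEquiv q k p (T.ballChild ⟨e.1, by rw [e.2]⟩ i) =
        p.2 e i := fun i => labelSuccEquiv_child _ _ _ _
    simp only [Sum.elim_inr, h1, h2]

theorem finprod_level_succ (hT : T.LocallyFinite) (k : ℕ) (F : T.Level (k + 1) → ℝ≥0∞) :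
    ∏ᶠ v, F v = ∏ᶠ e : T.LevelEdge k,
      ∏ i, F ⟨T.child e.1 i, by rw [T.depth_child, e.2]⟩ := by
  have := hT.finite_Level (k + 1)
  have := hT.finite_LevelEdge k
  have := Fintype.ofFinite (T.Level (k + 1))
  have := Fintype.ofFinite (T.LevelEdge k)
  simp only [finprod_eq_prod_of_fintype]
  have hbij : Function.Bijective (fun p => ⟨T.child p.1.1 p.2, by rw [T.depth_child, p.1.2]⟩ :
      T.LevelEdge k × Fin (r - 1) → T.Level (k + 1)) := by
    constructor
    · rintro ⟨⟨e, he⟩, i⟩ ⟨⟨e', he'⟩, i'⟩ h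
      simp only [Subtype.mk.injEq] at h
      obtain ⟨rfl, rfl⟩ := T.child_inj _ _ _ _ h
      rfl
    · rintro ⟨v, hv⟩
      obtain ⟨e, i, he, rfl⟩ := exists_child_of_depth hv
      exact ⟨(⟨e, he⟩, i), rfl⟩
  rw [← Fintype.prod_bijective _ hbij _ _ fun _ => rfl, Fintype.prod_prod_type]

theorem finprod_levelEdge (hT : T.LocallyFinite) (k : ℕ) (F : T.Level k → E → ℝ≥0∞) :
    ∏ᶠ e : T.LevelEdge k, F ⟨T.top e.1, e.2⟩ e.1 =
      ∏ᶠ v : T.Level k, ∏ e ∈ hT.downEdges v.1, F v e := by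
  classical
  have := hT.finite_Level k
  have := hT.finite_LevelEdge k
  have := Fintype.ofFinite (T.Level k)
  have := Fintype.ofFinite (T.LevelEdge k)
  simp only [finprod_eq_prod_of_fintype]
  rw [← Finset.prod_fiberwise Finset.univ (fun e : T.LevelEdge k => (⟨T.top e.1, e.2⟩ : T.Level k))]
  refine Fintype.prod_congr _ _ fun v => ?_
  refine Finset.prod_bij (fun e _ => e.1) ?_ ?_ ?_ ?_
  · intro e he
    simpa using congrArg Subtype.val (Finset.mem_filter.1 he).2
  · intro e _ e' _ h
    exact Subtype.ext h
  · intro e he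
    rw [hT.mem_downEdges] at he
    exact ⟨⟨e, he ▸ v.2⟩, by simp [he], rfl⟩
  · intro e he
    rw [(Finset.mem_filter.1 he).2]

/-! ### Messages -/

/-- Integrating out the labels of a ball level by level, for messages satisfying the recursion of
the broadcasting process. -/
theorem tsum_labelProb_mul (hT : T.LocallyFinite) (M : Params q r) (m : V → Fin q → ℝ≥0∞)
    (a : Fin q) (k : ℕ)
    (hm : ∀ v, T.depth v < k → ∀ b, m v b =
      ∏ e ∈ hT.downEdges v, ∑ z, M.B b {z} * ∏ i, m (T.child e i) (z i)) :
    ∑' x : T.Ball k → Fin q, (if x (T.ballRoot k) = a then T.labelProb M k x else 0) *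
      ∏ᶠ v : T.Level k, m v.1 (x (T.ballOfLevel v)) = M.π {a} * m T.root a := by
  classical
  induction k with
  | zero =>
    have hu : ∀ v : T.Ball 0, v = T.ballRoot 0 := fun v =>
      Subtype.ext (depth_eq_zero_iff.1 (Nat.le_zero.1 v.2))
    have hE : IsEmpty (T.BallEdge 0) := ⟨fun e => by have := e.2; omega⟩
    let lv : T.Level 0 := ⟨T.root, T.depth_root⟩
    have hl : ∀ v : T.Level 0, v = lv := fun v => Subtype.ext (depth_eq_zero_iff.1 v.2)
    rw [tsum_eq_single (fun _ => a)]
    · rw [if_pos rfl, labelProb, finprod_of_isEmpty, mul_one]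
      congr 1
      have : Unique (T.Level 0) := ⟨⟨lv⟩, hl⟩
      rw [finprod_unique]
      rw [hl default]
    · intro x hx
      rw [if_neg, zero_mul]
      intro h
      exact hx (funext fun v => by rw [hu v, h])
  | succ k ih =>
    rw [← ih fun v hv => hm v (hv.trans (Nat.lt_succ_self k))]
    have := hT.finite_LevelEdge k
    have := Fintype.ofFinite (T.LevelEdge k)
    rw [← (T.labelSuccEquiv q k).tsum_eq, ENNReal.tsum_prod']
    refine tsum_congr fun x => ?_
    have hroot : ∀ z, T.labelSuccEquiv q k (x, z) (T.ballRoot (k + 1)) = x (T.ballRoot k) :=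
      fun z => labelSuccEquiv_of_le _ _ _
    simp_rw [labelProb_succ hT, hroot, finprod_level_succ hT]
    have hc : ∀ z (e : T.LevelEdge k) (i : Fin (r - 1)), T.labelSuccEquiv q k (x, z)
        (T.ballOfLevel ⟨T.child e.1 i, by rw [T.depth_child, e.2]⟩) = z e i :=
      fun z e i => labelSuccEquiv_child _ _ _ _
    simp_rw [hc, ← ite_zero_mul, mul_assoc, ENNReal.tsum_mul_left]
    congr 1
    have hv : ∀ v : T.Level k, m v.1 (x (T.ballOfLevel v)) = ∏ e ∈ hT.downEdges v.1,
        ∑ z, M.B (x (T.ballOfLevel v)) {z} * ∏ i, m (T.child e i) (z i) := fun v =>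
      hm v.1 (by rw [v.2]; exact Nat.lt_succ_self k) _
    simp_rw [hv]
    rw [← finprod_levelEdge hT k fun v e =>
      ∑ z, M.B (x (T.ballOfLevel v)) {z} * ∏ i, m (T.child e i) (z i)]
    simp only [finprod_eq_prod_of_fintype]
    -- Distributivity: the product over new hyperedges of sums over their labels is one sum over all
    -- joint labellings.
    rw [tsum_fintype, Finset.prod_univ_sum, Fintype.piFinset_univ]
    simp_rw [Finset.prod_mul_distrib]
    rfl

/-! ### Observing a level below a vertex. -/

open ObsChannel

variable {r : ℕ} {V E : Type*} {T : RootedHypertree r V E} {q : ℕ}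

/-- The observation of the labels of the descendants of a vertex `n` levels below it. -/
noncomputable def LocallyFinite.chan (hT : T.LocallyFinite) (M : Params q r) :
    ℕ → V → ObsChannel V q
  | 0, v => ident v
  | n + 1, v => prodList ((hT.downEdges v).toList.map fun e =>
      node M fun i => hT.chan M n (T.child e i))

/-- The likelihoods obey exactly the message recursion required by `tsum_labelProb_mul`. -/
theorem LocallyFinite.mass_chan_succ (hT : T.LocallyFinite) (M : Params q r) (n : ℕ) (v : V)
    (x : V → Fin q) (a : Fin q) : (hT.chan M (n + 1) v).mass x a =
      ∏ e ∈ hT.downEdges v, ∑ z, M.B a {z} * ∏ i, (hT.chan M n (T.child e i)).mass x (z i) := by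
  rw [LocallyFinite.chan, mass_prodList, List.map_map, Finset.prod_map_toList]
  exact Finset.prod_congr rfl fun e _ => mass_node _ _ _ _

theorem obs_prodList_eq {l : List (ObsChannel V q)} {x x' : V → Fin q}
    (h : (prodList l).obs x = (prodList l).obs x') : ∀ c ∈ l, c.obs x = c.obs x' := by
  induction l with
  | nil => simp
  | cons d l ih =>
    have h' := Prod.ext_iff.1 h
    intro c hc
    rcases List.mem_cons.1 hc with rfl | hc
    · exact h'.1
    · exact ih h'.2 c hc

variable (T) in
/-- `w` is a descendant of `v`, `n` levels below it. -/
inductive Descendant : ℕ → V → V → Prop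
  | refl (v : V) : Descendant 0 v v
  | step {n : ℕ} {w : V} (e : E) (i : Fin (r - 1)) (h : Descendant n (T.child e i) w) :
      Descendant (n + 1) (T.top e) w

theorem Descendant.child {n : ℕ} {v w : V} (h : T.Descendant n v w) :
    ∀ e i, T.top e = w → T.Descendant (n + 1) v (T.child e i) := by
  induction h with
  | refl v => rintro e i rfl; exact .step e i (.refl _)
  | step e i _ ih => exact fun e' i' h => .step e i (ih e' i' h)

theorem descendant_root (k : ℕ) (w : V) (hw : T.depth w = k) : T.Descendant k T.root w := by
  induction k generalizing w with
  | zero => rw [depth_eq_zero_iff.1 hw]; exact .refl _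
  | succ k ih =>
    obtain ⟨e, i, he, rfl⟩ := exists_child_of_depth hw
    exact (ih _ he).child e i rfl

/-- Nothing is lost in the iterated observation: it determines each label `n` levels down. At the
root this makes level labellings inject into outputs. -/
theorem LocallyFinite.eq_of_obs_chan_eq (hT : T.LocallyFinite) (M : Params q r) {n : ℕ} {v w : V}
    (hw : T.Descendant n v w) {x x' : V → Fin q}
    (h : (hT.chan M n v).obs x = (hT.chan M n v).obs x') : x w = x' w := by
  induction hw with
  | refl v => exact h
  | step e i _ ih =>
    refine ih ?_
    have h1 := obs_prodList_eq h (node M fun i => hT.chan M _ (T.child e i))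
      (List.mem_map.2 ⟨e, by simp, rfl⟩)
    exact congrFun h1 i

/-! ### The law of the root and of a level -/

section LevelLaw

variable [NeZero q]

variable (T q) in
/-- Extension by `0` of a labelling of a level. -/
noncomputable def levelExt (k : ℕ) (y : T.Level k → Fin q) (w : V) : Fin q :=
  open Classical in if h : T.depth w = k then y ⟨w, h⟩ else 0

theorem levelExt_apply {k : ℕ} (y : T.Level k → Fin q) (w : T.Level k) :
    T.levelExt q k y w.1 = y w := by
  simp [levelExt, w.2]

open Classical in
theorem tsum_labelProb_eq (hT : T.LocallyFinite) (M : Params q r) (k : ℕ) (a : Fin q)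
    (y : T.Level k → Fin q) :
    ∑' x : T.Ball k → Fin q, (if x (T.ballRoot k) = a then T.labelProb M k x else 0) *
      (if ∀ v, x (T.ballOfLevel v) = y v then 1 else 0) =
      M.π {a} * (hT.chan M k T.root).mass (T.levelExt q k y) a := by
  have := hT.finite_Level k
  have := Fintype.ofFinite (T.Level k)
  -- The message at `v` is the likelihood of the level labelling `y` below `v`; at depth `k` it
  -- becomes the indicator that the label agrees with `y`.
  have key := tsum_labelProb_mul hT M
    (fun v b => (hT.chan M (k - T.depth v) v).mass (T.levelExt q k y) b) a k ?_
  · simp only [T.depth_root, Nat.sub_zero] at key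
    rw [← key]
    refine tsum_congr fun x => ?_
    congr 1
    have hv : ∀ v : T.Level k, (hT.chan M (k - T.depth v.1) v.1).mass (T.levelExt q k y)
        (x (T.ballOfLevel v)) = if x (T.ballOfLevel v) = y v then 1 else 0 := by
      intro v
      rw [v.2, Nat.sub_self, LocallyFinite.chan, mass_ident, levelExt_apply]
    simp_rw [hv]
    rw [finprod_eq_prod_of_fintype, Finset.prod_ite_zero]
    simp
  · intro v hv b
    obtain ⟨n, hn⟩ := Nat.exists_eq_add_of_lt hv
    have h1 : k - T.depth v = n + 1 := by omega
    rw [h1, LocallyFinite.mass_chan_succ]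
    refine Finset.prod_congr rfl fun e he => Finset.sum_congr rfl fun z _ => ?_
    congr 1
    refine Finset.prod_congr rfl fun i _ => ?_
    have h2 : k - T.depth (T.child e i) = n := by
      rw [T.depth_child, hT.mem_downEdges.1 he]; omega
    rw [h2]

theorem rootLevelLaw_singleton (hT : T.LocallyFinite) (M : Params q r) (k : ℕ) (a : Fin q)
    (y : T.Level k → Fin q) : T.rootLevelLaw M k {(a, y)} =
      M.π {a} * (hT.chan M k T.root).mass (T.levelExt q k y) a := by
  have := hT.finite_Ball k
  have := hT.finite_Level k
  rw [← tsum_labelProb_eq, rootLevelLaw, ballLaw, Measure.map_apply (measurable_of_finite _)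
    (measurableSet_singleton _), Measure.sum_apply _ (Set.toFinite _).measurableSet]
  refine tsum_congr fun x => ?_
  rw [Measure.smul_apply, Measure.dirac_apply' _ (Set.toFinite _).measurableSet, smul_eq_mul]
  by_cases h2 : (fun v => x (T.ballOfLevel v)) = y
  · rw [if_pos (congrFun h2)]
    by_cases h1 : x (T.ballRoot k) = a <;> simp [Set.indicator, h1, h2]
  · rw [if_neg fun h => h2 (funext h)]
    simp [Set.indicator, h2]

theorem isProbabilityMeasure_rootLevelLaw (hT : T.LocallyFinite) (M : Params q r) (k : ℕ) :
    IsProbabilityMeasure (T.rootLevelLaw M k) := by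
  have := hT.finite_Ball k
  have := hT.finite_Level k
  refine ⟨?_⟩
  rw [rootLevelLaw, ballLaw, Measure.map_apply (measurable_of_finite _) .univ,
    Set.preimage_univ, Measure.sum_apply _ .univ]
  have key : ∀ a, ∑' x : T.Ball k → Fin q,
      (if x (T.ballRoot k) = a then T.labelProb M k x else 0) = M.π {a} := fun a => by
    -- The constant message `1` solves the recursion because `B` is Markov.
    have := tsum_labelProb_mul hT M (fun _ _ => 1) a k fun v _ b => by simp
    simpa using this
  have h1 : ∑ a, ∑' x : T.Ball k → Fin q,
      (if x (T.ballRoot k) = a then T.labelProb M k x else 0) = 1 := by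
    simp_rw [key]
    simp
  rw [← h1, ← tsum_fintype (L := .unconditional _), ENNReal.tsum_comm]
  refine tsum_congr fun x => ?_
  simp

/-- The encoding `R` of level labels as channel outputs is injective, so the law of root and level
is the image of the channel's joint law under a left inverse of `R`, and KL data processing applies.
-/
theorem jointInfo_rootLevelLaw_le (hT : T.LocallyFinite) (M : Params q r) (k : ℕ) :
    jointInfo .kl (T.rootLevelLaw M k) ≤ (hT.chan M k T.root).info .kl M.π := by
  have := hT.finite_Level k
  have := isProbabilityMeasure_rootLevelLaw hT M k
  have := Fintype.ofFinite (T.Level k → Fin q)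
  set c := hT.chan M k T.root
  set J := T.rootLevelLaw M k with hJ
  let R : (T.Level k → Fin q) → c.Y := fun y => c.obs (T.levelExt q k y)
  have hR : Function.Injective R := fun y y' h => funext fun w => by
    rw [← levelExt_apply y, ← levelExt_apply y']
    exact hT.eq_of_obs_chan_eq M (descendant_root k w.1 w.2) h
  let G := Function.invFun R
  have hG : ∀ y, G (R y) = y := Function.leftInverse_invFun hR
  have hmR : Measurable R := measurable_of_finite R
  have hmG : Measurable G := measurable_of_finite G
  have hinj : Function.Injective (Prod.map id R : Fin q × (T.Level k → Fin q) → _) :=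
    Function.injective_id.prodMap hR
  have hmap : J.map (Prod.map id R) = M.π ⊗ₘ c.kernel := by
    have : IsProbabilityMeasure (J.map (Prod.map id R)) :=
      Measure.isProbabilityMeasure_map (measurable_of_finite _).aemeasurable
    -- Comparing two probability measures, one inequality suffices, so outputs outside the range of
    -- `R` need no computation of their mass.
    refine Measure.eq_of_le_of_measure_univ_eq (measure_le_of_singleton fun p => ?_) (by simp)
    rw [Measure.map_apply (measurable_of_finite _) (measurableSet_singleton _)]
    by_cases hp : p ∈ Set.range (Prod.map id R)
    · obtain ⟨⟨a, y⟩, rfl⟩ := hp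
      rw [← Set.image_singleton, Set.preimage_image_eq _ hinj, Set.image_singleton,
        rootLevelLaw_singleton hT, Prod.map_apply, compProd_singleton]
      rfl
    · rw [Set.preimage_singleton_eq_empty.2 hp, measure_empty]
      exact zero_le
  have hJ' : J = (M.π ⊗ₘ c.kernel).map (Prod.map id G) := by
    rw [← hmap, Measure.map_map (measurable_of_finite _) (measurable_of_finite _),
      Prod.map_comp_map]
    have : G ∘ R = id := funext hG
    rw [this, Function.comp_id, Prod.map_id, Measure.map_id]
  have hfst : J.fst = (M.π ⊗ₘ c.kernel).fst := by
    rw [hJ', Measure.fst, Measure.fst, Measure.map_map measurable_fst (measurable_of_finite _)]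
    rfl
  have hsnd : J.snd = (M.π ⊗ₘ c.kernel).snd.map G := by
    rw [hJ', Measure.snd, Measure.snd, Measure.map_map measurable_snd (measurable_of_finite _),
      Measure.map_map hmG measurable_snd]
    rfl
  have hprod : J.fst.prod J.snd =
      ((M.π ⊗ₘ c.kernel).fst.prod (M.π ⊗ₘ c.kernel).snd).map (Prod.map id G) := by
    rw [hfst, hsnd, ← Measure.map_prod_map _ _ measurable_id hmG, Measure.map_id]
  rw [jointInfo, hprod, hJ', info, channelInfo, jointInfo]
  exact klDiv_map_le _ _ (measurable_of_finite _)

end LevelLaw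

/-! ### Contraction along the hypertree -/

section Contraction

variable {f : Divergence} {M : Params q r} {η : ℝ≥0∞} {G : ObsChannel V q → Prop}

theorem chan_mem (hT : T.LocallyFinite) (h : IsContractive f M η G) (n : ℕ) (v : V) :
    G (hT.chan M n v) := by
  induction n generalizing v with
  | zero => exact h.ident v
  | succ n ih =>
    refine h.prodList _ fun c hc => ?_
    obtain ⟨e, -, rfl⟩ := List.mem_map.1 hc
    exact h.node _ fun i => ih _

theorem info_chan_succ_le_sum_node (hT : T.LocallyFinite) (h : IsContractive f M η G) (n : ℕ)
    (v : V) : (hT.chan M (n + 1) v).info f M.π ≤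
      ∑ e ∈ hT.downEdges v, (node M fun i => hT.chan M n (T.child e i)).info f M.π := by
  refine (h.info_prodList_le _ fun c hc => ?_).trans ?_
  · obtain ⟨e, -, rfl⟩ := List.mem_map.1 hc
    exact h.node _ fun i => chan_mem hT h _ _
  · rw [List.map_map, Finset.sum_map_toList]
    rfl

theorem info_chan_succ_le (hT : T.LocallyFinite) (h : IsContractive f M η G) (n : ℕ) (v : V)
    (hfin : ∀ w, (hT.chan M n w).info f M.π < ∞) : (hT.chan M (n + 1) v).info f M.π ≤
      η * ∑ e ∈ hT.downEdges v, ∑ i, (hT.chan M n (T.child e i)).info f M.π := by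
  refine (info_chan_succ_le_sum_node hT h n v).trans ?_
  rw [Finset.mul_sum]
  exact Finset.sum_le_sum fun e _ => h.info_node_le _ (fun i => chan_mem hT h _ _)
    (ENNReal.sum_lt_top.2 fun i _ => hfin _)

/-- Each hyperedge observation is a degraded version of the output of `B`, and at most `N` of them
are combined. The index `n + 1` matters: for `q ≥ 2`, observing the label itself has infinite SKL
information. -/
theorem info_chan_skl_le (hT : T.LocallyFinite) (h : IsContractive .skl M η G) {N : ℕ}
    (hN : ∀ w, {e | w ∈ T.edgeSet e}.encard ≤ N) (n : ℕ) (v : V) :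
    (hT.chan M (n + 1) v).info .skl M.π ≤ N * channelInfo .skl M.π M.B := by
  refine (info_chan_succ_le_sum_node hT h n v).trans ?_
  refine (Finset.sum_le_card_nsmul _ _ (channelInfo .skl M.π M.B) fun e _ =>
    channelInfo_comp_skl_le _ _ _).trans ?_
  rw [nsmul_eq_mul]
  gcongr
  have h1 : ((hT.downEdges v : Finset E) : Set E) ⊆ {e | v ∈ T.edgeSet e} := fun e he => by
    rw [Finset.mem_coe, hT.mem_downEdges] at he
    exact he ▸ Set.mem_insert _ _
  have h2 := (Set.encard_le_encard h1).trans (hN v)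
  rw [Set.encard_coe_eq_coe_finsetCard] at h2
  exact_mod_cast h2

end Contraction

variable {r : ℕ} {V E : Type*} {T : RootedHypertree r V E}

/-! ### Flows -/

theorem LocallyFinite.isFlow (hT : T.LocallyFinite) {f : V → ℝ≥0}
    (hf : ∀ v, f v = ∑ e ∈ hT.downEdges v, ∑ i, f (T.child e i)) : T.IsFlow f := by
  intro w
  have hbij : Function.Bijective (fun p => ⟨T.child p.1.1 p.2, p.1.1, p.2,
      hT.mem_downEdges.1 p.1.2, rfl⟩ :
      {e // e ∈ hT.downEdges w} × Fin (r - 1) → {c // T.IsChild w c}) := by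
    constructor
    · rintro ⟨⟨e, he⟩, i⟩ ⟨⟨e', he'⟩, i'⟩ h
      obtain ⟨rfl, rfl⟩ := T.child_inj e i e' i' (congrArg Subtype.val h)
      rfl
    · rintro ⟨c, e, i, he, rfl⟩
      exact ⟨(⟨e, hT.mem_downEdges.2 he⟩, i), rfl⟩
  rw [← (Equiv.ofBijective _ hbij).hasSum_iff]
  have h := hasSum_fintype (fun p : {e // e ∈ hT.downEdges w} × Fin (r - 1) =>
    f (T.child p.1.1 p.2))
  rw [Fintype.sum_prod_type, Finset.sum_coe_sort (hT.downEdges w)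
    (fun e => ∑ i, f (T.child e i)), ← hf] at h
  exact h

variable (T) in
/-- The top vertex of the hyperedge above a vertex. -/
noncomputable def parent (v : V) : V :=
  open Classical in if h : ∃ e i, T.child e i = v then T.top h.choose else v

theorem parent_child (e : E) (i : Fin (r - 1)) : T.parent (T.child e i) = T.top e := by
  have h : ∃ e' i', T.child e' i' = T.child e i := ⟨e, i, rfl⟩
  rw [parent, dif_pos h, (T.child_inj _ _ _ _ h.choose_spec.choose_spec).1]

/-- A function which is at most the sum of its values at the children dominates a flow with the
same value at the root. -/
theorem LocallyFinite.exists_flow_le (hT : T.LocallyFinite) (g : V → ℝ≥0) (K : ℕ)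
    (hg : ∀ v, T.depth v < K → g v ≤ ∑ e ∈ hT.downEdges v, ∑ i, g (T.child e i)) :
    ∃ f : V → ℝ≥0, f T.root = g T.root ∧ (∀ v, T.depth v ≤ K → f v ≤ g v) ∧
      ∀ v, T.depth v < K → f v = ∑ e ∈ hT.downEdges v, ∑ i, f (T.child e i) := by
  set S : V → ℝ≥0 := fun v => ∑ e ∈ hT.downEdges v, ∑ i, g (T.child e i) with hS
  -- Send the mass `g root` downwards, splitting it at each vertex among the children in proportion
  -- to `g`; the product runs along the path to the root.
  let f : V → ℝ≥0 := fun v => g T.root *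
    ∏ j ∈ Finset.range (T.depth v), g (T.parent^[j] v) / S (T.parent^[j + 1] v)
  have hchild : ∀ e i, f (T.child e i) = f (T.top e) * (g (T.child e i) / S (T.top e)) := by
    intro e i
    simp only [f, T.depth_child, Finset.prod_range_succ']
    simp only [Function.iterate_succ_apply, Function.iterate_zero, id_eq, parent_child, mul_assoc]
  have hle : ∀ k ≤ K, ∀ v, T.depth v = k → f v ≤ g v := by
    intro k
    induction k with
    | zero =>
      intro _ v hv
      obtain rfl := depth_eq_zero_iff.1 hv
      simp [f, T.depth_root]
    | succ k ih =>
      intro hk v hv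
      obtain ⟨e, i, he, rfl⟩ := exists_child_of_depth hv
      rw [hchild]
      have h1 : f (T.top e) ≤ S (T.top e) :=
        (ih (by omega) _ he).trans (hg _ (by omega))
      calc f (T.top e) * (g (T.child e i) / S (T.top e))
          ≤ S (T.top e) * (g (T.child e i) / S (T.top e)) := by gcongr
        _ ≤ g (T.child e i) := by
          rcases eq_or_ne (S (T.top e)) 0 with h0 | h0
          · simp [h0]
          · rw [mul_div_cancel₀ _ h0]
  refine ⟨f, by simp [f, T.depth_root], fun v hv => hle _ hv v rfl, fun v hv => ?_⟩
  have h1 : ∑ e ∈ hT.downEdges v, ∑ i, f (T.child e i) = f v * (S v / S v) := by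
    rw [div_eq_mul_inv (S v), hS, Finset.sum_mul, Finset.mul_sum]
    refine Finset.sum_congr rfl fun e he => ?_
    rw [Finset.sum_mul, Finset.mul_sum]
    refine Finset.sum_congr rfl fun i _ => ?_
    rw [hchild, hT.mem_downEdges.1 he, div_eq_mul_inv]
  rw [h1]
  -- If the children carry no `g`-mass, the proportions are `0 / 0`, but then `f v ≤ g v ≤ S v = 0`.
  by_cases h0 : S v = 0
  · have : f v = 0 := le_antisymm (((hle _ hv.le v rfl).trans (hg v hv)).trans h0.le) zero_le
    rw [this, zero_mul]
  · rw [div_self h0, mul_one]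

/-- A limit of subflows on balls of growing radii gives a lower bound for the branching number. -/
theorem LocallyFinite.le_branchingNumber (hT : T.LocallyFinite) {l C : ℝ≥0} (hl : 0 < l)
    (g : ℕ → V → ℝ≥0)
    (hg : ∀ K v, T.depth v < K → g K v ≤ ∑ e ∈ hT.downEdges v, ∑ i, g K (T.child e i))
    (hC : ∀ K v, T.depth v ≤ K → g K v ≤ C * (l ^ T.depth v)⁻¹)
    (h0 : ¬ Tendsto (fun K => g K T.root) atTop (𝓝 0)) : (l : ℝ≥0∞) ≤ T.branchingNumber := by
  choose f hroot hle hflow using fun K => hT.exists_flow_le (g K) K (hg K)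
  obtain ⟨ε, hε, hfreq⟩ : ∃ ε > 0, ∃ᶠ K in atTop, ε ≤ g K T.root := by
    by_contra! h
    refine h0 (tendsto_order.2 ⟨fun a ha => absurd ha not_lt_zero, fun a ha => ?_⟩)
    exact h a ha
  -- An ultrafilter at infinity concentrated on radii with root value at least `ε` gives limits at
  -- all vertices simultaneously and keeps the root value positive. The flow equations are finite
  -- sums, hence survive the limit.
  have hne : (atTop ⊓ 𝓟 {K | ε ≤ g K T.root}).NeBot := frequently_mem_iff_neBot.1 hfreq
  let 𝒰 : Ultrafilter ℕ := Ultrafilter.of (atTop ⊓ 𝓟 {K | ε ≤ g K T.root})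
  have hU : (𝒰 : Filter ℕ) ≤ atTop ⊓ 𝓟 {K | ε ≤ g K T.root} := Ultrafilter.of_le _
  have hUtop : (𝒰 : Filter ℕ) ≤ atTop := hU.trans inf_le_left
  have hUε : ∀ᶠ K in (𝒰 : Filter ℕ), ε ≤ g K T.root :=
    (hU.trans inf_le_right) (mem_principal_self _)
  have hev : ∀ v, ∀ᶠ K in (𝒰 : Filter ℕ), T.depth v < K := fun v =>
    hUtop (eventually_gt_atTop _)
  have hlim : ∀ v, ∃ y ≤ C * (l ^ T.depth v)⁻¹, Tendsto (fun K => f K v) 𝒰 (𝓝 y) := by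
    intro v
    have hmem : ∀ᶠ K in (𝒰 : Filter ℕ), f K v ∈ Set.Icc 0 (C * (l ^ T.depth v)⁻¹) :=
      (hev v).mono fun K hK => ⟨zero_le, (hle K v hK.le).trans (hC K v hK.le)⟩
    obtain ⟨y, hy, hlim⟩ := (isCompact_Icc (a := (0 : ℝ≥0))
      (b := C * (l ^ T.depth v)⁻¹)).ultrafilter_le_nhds (𝒰.map fun K => f K v)
      (le_principal_iff.2 hmem)
    exact ⟨y, hy.2, hlim⟩
  choose φ hφle hφ using hlim
  have hφroot : ε ≤ φ T.root :=
    ge_of_tendsto (hφ T.root) (hUε.mono fun K hK => by rwa [hroot])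
  have hφflow : ∀ v, φ v = ∑ e ∈ hT.downEdges v, ∑ i, φ (T.child e i) := fun v =>
    tendsto_nhds_unique_of_eventuallyEq (hφ v)
      (tendsto_finsetSum _ fun e _ => tendsto_finsetSum _ fun i _ => hφ _)
      ((hev v).mono fun K hK => hflow K v hK)
  have hCpos : 0 < C := by
    have := hε.trans_le (hφroot.trans (hφle T.root))
    simpa [T.depth_root] using this
  refine le_iSup₂_of_le l ⟨hl, fun v => φ v / C, hT.isFlow fun v => ?_,
    div_pos (hε.trans_le hφroot) hCpos, fun v => ?_⟩ le_rfl
  · simp_rw [← Finset.sum_div, ← hφflow]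
  · rw [div_le_iff₀ hCpos, mul_comm]
    exact hφle v

/-- Quantities contracting along the hypertree by a factor `η` with `br(T) η < 1` tend to `0` at
the root. -/
theorem LocallyFinite.tendsto_zero_of_contraction (hT : T.LocallyFinite) {η C : ℝ≥0∞}
    (hη : T.branchingNumber * η < 1) (a : ℕ → V → ℝ≥0∞)
    (hrec : ∀ n v, a (n + 1) v ≤ η * ∑ e ∈ hT.downEdges v, ∑ i, a n (T.child e i))
    (hC : C ≠ ∞) (hbdd : ∀ n v, a n v ≤ C) : Tendsto (fun n => a n T.root) atTop (𝓝 0) := by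
  classical
  by_contra hnot
  have hsucc : ∀ {K : ℕ} {v : V}, T.depth v < K → ∃ n, K - T.depth v = n + 1 ∧
      ∀ e ∈ hT.downEdges v, ∀ i, K - T.depth (T.child e i) = n := by
    intro K v hv
    refine ⟨K - T.depth v - 1, by omega, fun e he i => ?_⟩
    rw [T.depth_child, hT.mem_downEdges.1 he]
    omega
  -- The convention `0 * ∞ = 0` allows `η = ∞` when `br(T) = 0`. The indicators of nonzero `a` form
  -- subflows, since a nonzero value forces a nonzero child; thus `br(T) ≥ 1`, and so `η < 1`.
  have hbr : 1 ≤ T.branchingNumber := by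
    refine hT.le_branchingNumber (l := 1) (C := 1) one_pos
      (fun K v => if a (K - T.depth v) v = 0 then 0 else 1) (fun K v hv => ?_)
      (fun K v _ => by split_ifs <;> simp) fun h => hnot ?_
    · obtain ⟨n, hn, hn'⟩ := hsucc hv
      split_ifs with h0
      · exact zero_le
      · have hex : ∃ e ∈ hT.downEdges v, ∃ i, a n (T.child e i) ≠ 0 := by
          by_contra! hz
          refine h0 (le_antisymm ?_ zero_le)
          rw [hn]
          refine (hrec n v).trans ?_
          rw [Finset.sum_eq_zero fun e he => Finset.sum_eq_zero fun i _ => hz e he i, mul_zero]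
        obtain ⟨e, he, i, hi⟩ := hex
        refine le_trans ?_ (Finset.single_le_sum (fun _ _ => zero_le) he)
        refine le_trans ?_ (Finset.single_le_sum (fun _ _ => zero_le) (Finset.mem_univ i))
        rw [hn' e he i, if_neg hi]
    · have h1 := h.eventually (gt_mem_nhds (zero_lt_one (α := ℝ≥0)))
      refine tendsto_const_nhds.congr' (h1.mono fun K hK => ?_)
      by_contra h2
      simp [T.depth_root, Ne.symm h2] at hK
  have hη1 : η < 1 := (le_mul_of_one_le_left zero_le hbr).trans_lt hη
  have hηtop : η ≠ ∞ := (hη1.trans ENNReal.one_lt_top).ne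
  rcases eq_or_ne η 0 with rfl | hη0
  · refine hnot ((tendsto_add_atTop_iff_nat 1).1 (tendsto_const_nhds.congr fun n => ?_))
    exact (le_antisymm ((hrec n T.root).trans (by simp)) zero_le).symm
  have hfin : ∀ n v, a n v ≠ ∞ := fun n v => ((hbdd n v).trans_lt hC.lt_top).ne
  have hηpos : 0 < η.toNNReal := ENNReal.toNNReal_pos hη0 hηtop
  -- The weight `η ^ depth` absorbs the factor lost at each level, turning the contraction into the
  -- subflow inequality with `l = 1 / η`.
  have hle : ((η.toNNReal⁻¹ : ℝ≥0) : ℝ≥0∞) ≤ T.branchingNumber := by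
    refine hT.le_branchingNumber (C := C.toNNReal) (inv_pos.2 hηpos)
      (fun K v => η.toNNReal ^ T.depth v * (a (K - T.depth v) v).toNNReal) (fun K v hv => ?_)
      (fun K v _ => ?_) fun h => hnot ?_
    · obtain ⟨n, hn, hn'⟩ := hsucc hv
      have h1 : (a (n + 1) v).toNNReal ≤
          η.toNNReal * ∑ e ∈ hT.downEdges v, ∑ i, (a n (T.child e i)).toNNReal := by
        rw [← ENNReal.coe_le_coe, ENNReal.coe_toNNReal (hfin _ _)]
        push_cast
        simp_rw [ENNReal.coe_toNNReal (hfin _ _), ENNReal.coe_toNNReal hηtop]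
        exact hrec n v
      rw [hn]
      refine (mul_le_mul_right h1 _).trans (le_of_eq ?_)
      rw [← mul_assoc, ← pow_succ, Finset.mul_sum]
      refine Finset.sum_congr rfl fun e he => ?_
      rw [Finset.mul_sum]
      refine Finset.sum_congr rfl fun i _ => ?_
      rw [hn' e he i, T.depth_child, hT.mem_downEdges.1 he]
    · rw [inv_pow, inv_inv, mul_comm]
      exact mul_le_mul_left (ENNReal.toNNReal_mono hC (hbdd _ _)) _
    · simp only [T.depth_root, pow_zero, one_mul, Nat.sub_zero] at h
      have h1 := ENNReal.tendsto_coe.2 h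
      simpa only [ENNReal.coe_toNNReal (hfin _ _), ENNReal.coe_zero] using h1
  rw [ENNReal.coe_inv hηpos.ne', ENNReal.coe_toNNReal hηtop] at hle
  refine hη.not_ge ?_
  calc (1 : ℝ≥0∞) = η⁻¹ * η := (ENNReal.inv_mul_cancel hη0 hηtop).symm
    _ ≤ T.branchingNumber * η := by gcongr

/-! ### Impossibility of reconstruction -/

open ObsChannel

section Impossibility

variable {q : ℕ} [NeZero q] {f : Divergence} {M : Params q r} {η : ℝ≥0∞}
  {G : ObsChannel V q → Prop}

/-- Reconstruction is impossible if the information observed from `n₀` or more levels below is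
uniformly bounded and contracts. -/
theorem reconstructionImpossible_of_bounded (hT : T.LocallyFinite) (h : IsContractive f M η G)
    (hη : T.branchingNumber * η < 1) {C : ℝ≥0∞} (hC : C ≠ ∞) (n₀ : ℕ)
    (hbdd : ∀ n v, (hT.chan M (n + n₀) v).info f M.π ≤ C) : T.ReconstructionImpossible M := by
  have h1 := hT.tendsto_zero_of_contraction hη (fun n v => (hT.chan M (n + n₀) v).info f M.π)
    (fun n v => by
      rw [show n + 1 + n₀ = n + n₀ + 1 by omega]
      exact info_chan_succ_le hT h (n + n₀) v fun w => (hbdd n w).trans_lt hC.lt_top) hC hbdd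
  have h2 := (tendsto_add_atTop_iff_nat (f := fun n => (hT.chan M n T.root).info f M.π) n₀).1 h1
  exact tendsto_of_tendsto_of_tendsto_of_le_of_le tendsto_const_nhds h2 (fun _ => zero_le)
    fun k => (jointInfo_rootLevelLaw_le hT M k).trans
      (channelInfo_kl_le _ _ f M.full_support)

theorem reconstructionImpossible_of_ne_skl (hT : T.LocallyFinite) (h : IsContractive f M η G)
    (hf : f ≠ .skl) (hη : T.branchingNumber * η < 1) : T.ReconstructionImpossible M := by
  refine reconstructionImpossible_of_bounded hT h hη (C := q) (by simp) 0 fun n v => ?_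
  have h1 := channelInfo_chiSq_le M.π (hT.chan M (n + 0) v).kernel M.full_support
  rw [Fintype.card_fin] at h1
  cases f with
  | kl => exact (channelInfo_kl_le_chiSq _ _ M.full_support).trans h1
  | chiSq => exact h1
  | skl => exact absurd rfl hf

theorem reconstructionImpossible_of_skl (hT : T.LocallyFinite) (h : IsContractive .skl M η G)
    (hη : T.branchingNumber * η < 1) (hB : channelInfo .skl M.π M.B < ∞)
    (hdeg : T.BoundedDegree) : T.ReconstructionImpossible M := by
  obtain ⟨N, hN⟩ := hdeg
  -- The offset `1` skips the identity observation, which the SKL bound does not cover.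
  exact reconstructionImpossible_of_bounded hT h hη
    (ENNReal.mul_ne_top (ENNReal.natCast_ne_top N) hB.ne) 1 fun n v => info_chan_skl_le hT h hN n v

end Impossibility

end RootedHypertree

end BOHT

/-! ### The five impossibility criteria. -/

theorem mainTheorem8 {r : ℕ} (hr : 2 ≤ r) {V : Type*} {E : Type*}
    (T : BOHT.RootedHypertree r V E) (hT : T.LocallyFinite) :
    (∀ (q : ℕ) (_ : 2 ≤ q) (M : BOHT.Params q r),
      (T.branchingNumber * BOHT.etaHet .kl M < 1 ∨
        (T.branchingNumber * BOHT.etaHet .skl M < 1 ∧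
          BOHT.channelInfo .skl M.π M.B < ∞ ∧ T.BoundedDegree)) →
      T.ReconstructionImpossible M) ∧
    (∀ M : BOHT.Params 2 r, M.IsBinarySymmetric →
      (T.branchingNumber * BOHT.etaHetSymm .kl M < 1 ∨
        T.branchingNumber * BOHT.etaHetSymm .chiSq M < 1 ∨
        (T.branchingNumber * BOHT.etaHetSymm .skl M < 1 ∧
          BOHT.capacity .skl M.B < ∞ ∧ T.BoundedDegree)) →
      T.ReconstructionImpossible M) := by
  refine ⟨fun q hq M h => ?_, fun M hM h => ?_⟩
  · have : NeZero q := ⟨by omega⟩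
    rcases h with h | ⟨h, hB, hdeg⟩
    · exact BOHT.RootedHypertree.reconstructionImpossible_of_ne_skl hT (BOHT.ObsChannel.isContractive_etaHet (Or.inl rfl) M)
        (by simp) h
    · exact BOHT.RootedHypertree.reconstructionImpossible_of_skl hT (BOHT.ObsChannel.isContractive_etaHet (Or.inr rfl) M) h hB hdeg
  · rcases h with h | h | ⟨h, hB, hdeg⟩
    · exact BOHT.RootedHypertree.reconstructionImpossible_of_ne_skl hT (BOHT.ObsChannel.isContractive_etaHetSymm _ M hM) (by simp) h
    · exact BOHT.RootedHypertree.reconstructionImpossible_of_ne_skl hT (BOHT.ObsChannel.isContractive_etaHetSymm _ M hM) (by simp) h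
    · rw [BOHT.capacity, ← hM.1] at hB
      exact BOHT.RootedHypertree.reconstructionImpossible_of_skl hT (BOHT.ObsChannel.isContractive_etaHetSymm _ M hM) h hB hdeg
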